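/- Let $n$ be a number of lines and let $t^{\mathrm{ac}}_\ell, t^{\mathrm{br}}_\ell$ ($\ell\in\{1,\dots,n\}$) be positive integers, the acceleration and braking times. The complete one-station network $\mathcal E_n^{\mathrm{energy}}$ is the directed graph with vertices $(\ell,\mathrm{arr})$ and $(\ell,\mathrm{dep})$ for $\ell\in\{1,\dots,n\}$, with the waiting activities $((\ell,\mathrm{arr}),(\ell,\mathrm{dep}))$ for all $\ell$, and with the energy activities $((k,\mathrm{dep}),(\ell,\mathrm{arr}))$ for all $k,\ell$. An energy activity $((k,\mathrm{dep}),(\ell,\mathrm{arr}))$ has weight $t^{\min}_{k\ell}=\min\{t^{\mathrm{ac}}_k,t^{\mathrm{br}}_\ell\}$, a waiting activity has weight $0$, and the weight of a path is the sum of the weights of its arcs. Then there is an algorithm that, given $n$, $t^{\mathrm{ac}}$ and $t^{\mathrm{br}}$, computes a Hamiltonian path in $\mathcal E_n^{\mathrm{energy}}$ (as the sequence of its vertices) that traverses all waiting activities and has maximum weight among all Hamiltonian paths that do so, and whose running time is bounded by a polynomial in the binary encoding length of the input. (Running time is measured on a random access machine with addition and subtraction of natural numbers, under the logarithmic cost criterion.)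 -/

import Mathlib

/-! ### One-station networks for the energy problem -/

/-- The events of a one-station network with `n` lines: every line `ℓ` has one arrival and one
departure. -/
inductive StationEvent (n : ℕ) : Type
  | arr (ℓ : Fin n) : StationEvent n
  | dep (ℓ : Fin n) : StationEvent n

/-- The waiting activities: one arc from the arrival to the departure of each line. -/
def waitActivities (n : ℕ) : Set (StationEvent n × StationEvent n) :=
  {a | ∃ ℓ : Fin n, a = (StationEvent.arr ℓ, StationEvent.dep ℓ)}

/-- The possible energy activities of the complete network: one arc from every departure to every
arrival (the two lines may coincide). -/
def energyActivities (n : ℕ) : Set (StationEvent n × StationEvent n) :=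
  {a | ∃ k ℓ : Fin n, a = (StationEvent.dep k, StationEvent.arr ℓ)}

/-- The complete one-station network for the energy problem. -/
def energyNetwork (n : ℕ) : Digraph (StationEvent n) where
  Adj u v := (u, v) ∈ waitActivities n ∪ energyActivities n

/-- The arcs of a path that is given by the sequence of its vertices. -/
def pathArcs {V : Type*} (P : List V) : List (V × V) :=
  P.zip P.tail

/-- A Hamiltonian path of a digraph, given by the sequence of its vertices: consecutive vertices
are joined by arcs, and every vertex occurs exactly once. -/
structure IsHamiltonianPath {V : Type*} (D : Digraph V) (P : List V) : Prop where
  isChain : P.IsChain D.Adj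
  nodup : P.Nodup
  mem_all : ∀ v : V, v ∈ P

/-- The data of an energy instance on the complete one-station network that matter for Hamiltonian
paths: the number of lines and the positive integral acceleration and braking times. -/
structure EnergyInstance where
  n : ℕ
  tAc : Fin n → ℕ
  tBr : Fin n → ℕ
  tAc_pos : ∀ ℓ, 0 < tAc ℓ
  tBr_pos : ∀ ℓ, 0 < tBr ℓ

namespace EnergyInstance

/-- The weight of an activity: `t^min` on energy activities, `0` on all other arcs. -/
def arcWeight (I : EnergyInstance) : StationEvent I.n × StationEvent I.n → ℕ
  | (StationEvent.dep k, StationEvent.arr ℓ) => min (I.tAc k) (I.tBr ℓ)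
  | _ => 0

/-- The weight of a path. -/
def pathWeight (I : EnergyInstance) (P : List (StationEvent I.n)) : ℕ :=
  ((pathArcs P).map I.arcWeight).sum

/-- `P` is a Hamiltonian path in the network that traverses all waiting activities. -/
def IsAdmissiblePath (I : EnergyInstance) (P : List (StationEvent I.n)) : Prop :=
  IsHamiltonianPath (energyNetwork I.n) P ∧ ∀ a ∈ waitActivities I.n, a ∈ pathArcs P

/-- `P` has maximum weight among the Hamiltonian paths that traverse all waiting activities. -/
def IsMaxWeightPath (I : EnergyInstance) (P : List (StationEvent I.n)) : Prop :=
  I.IsAdmissiblePath P ∧ ∀ Q, I.IsAdmissiblePath Q → I.pathWeight Q ≤ I.pathWeight P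

end EnergyInstance

/-! ### Random access machines with logarithmic cost

Programs are written in structured form. A program mentions finitely many registers and finitely
many arrays; all contents are natural numbers of arbitrary size. The only arithmetic is addition
and truncated subtraction, and an instruction is charged the number of bits of all the numbers
that it handles, addresses into arrays included. Under this charge the model is polynomially
equivalent to multitape Turing machines. -/

/-- The memory of the machine. -/
@[ext]
structure RamState where
  reg : ℕ → ℕ
  arr : ℕ → ℕ → ℕ

namespace RamState

/-- Write `v` into register `x`. -/
def setReg (s : RamState) (x v : ℕ) : RamState where
  reg := Function.update s.reg x v
  arr := s.arr

/-- Write `v` into cell `i` of array `a`. -/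
def setArr (s : RamState) (a i v : ℕ) : RamState where
  reg := s.reg
  arr := Function.update s.arr a (Function.update (s.arr a) i v)

end RamState

/-- Programs. -/
inductive RamProgram : Type
  /-- do nothing -/
  | skip : RamProgram
  /-- `x := c` -/
  | const (x c : ℕ) : RamProgram
  /-- `x := y + z` -/
  | add (x y z : ℕ) : RamProgram
  /-- `x := max (y - z) 0` -/
  | sub (x y z : ℕ) : RamProgram
  /-- `x := a[y]` -/
  | load (x a y : ℕ) : RamProgram
  /-- `a[x] := y` -/
  | store (a x y : ℕ) : RamProgram
  /-- first `p`, then `q` -/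
  | seq (p q : RamProgram) : RamProgram
  /-- if `x ≠ 0` then `p` else `q` -/
  | cond (x : ℕ) (p q : RamProgram) : RamProgram
  /-- while `x ≠ 0` do `p` -/
  | loop (x : ℕ) (p : RamProgram) : RamProgram

/-- The charge for handling the number `v`: its length in binary, plus one. -/
def bitCost (v : ℕ) : ℕ :=
  Nat.size v + 1

/-- `RamRuns p s s' t`: the program `p`, started in the memory state `s`, halts in the state `s'`
after a computation of total logarithmic cost `t`. -/
inductive RamRuns : RamProgram → RamState → RamState → ℕ → Prop
  | skip (s : RamState) : RamRuns .skip s s 1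
  | const (s : RamState) (x c : ℕ) : RamRuns (.const x c) s (s.setReg x c) (bitCost c)
  | add (s : RamState) (x y z : ℕ) :
      RamRuns (.add x y z) s (s.setReg x (s.reg y + s.reg z))
        (bitCost (s.reg y) + bitCost (s.reg z))
  | sub (s : RamState) (x y z : ℕ) :
      RamRuns (.sub x y z) s (s.setReg x (s.reg y - s.reg z))
        (bitCost (s.reg y) + bitCost (s.reg z))
  | load (s : RamState) (x a y : ℕ) :
      RamRuns (.load x a y) s (s.setReg x (s.arr a (s.reg y)))
        (bitCost (s.reg y) + bitCost (s.arr a (s.reg y)))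
  | store (s : RamState) (a x y : ℕ) :
      RamRuns (.store a x y) s (s.setArr a (s.reg x) (s.reg y))
        (bitCost (s.reg x) + bitCost (s.reg y))
  | seq {p q : RamProgram} {s s' s'' : RamState} {t t' : ℕ} :
      RamRuns p s s' t → RamRuns q s' s'' t' → RamRuns (.seq p q) s s'' (t + t')
  | cond_pos {x : ℕ} {p q : RamProgram} {s s' : RamState} {t : ℕ} :
      s.reg x ≠ 0 → RamRuns p s s' t → RamRuns (.cond x p q) s s' (bitCost (s.reg x) + t)
  | cond_zero {x : ℕ} {p q : RamProgram} {s s' : RamState} {t : ℕ} :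
      s.reg x = 0 → RamRuns q s s' t → RamRuns (.cond x p q) s s' (bitCost (s.reg x) + t)
  | loop_done {x : ℕ} {p : RamProgram} {s : RamState} :
      s.reg x = 0 → RamRuns (.loop x p) s s (bitCost (s.reg x))
  | loop_step {x : ℕ} {p : RamProgram} {s s' s'' : RamState} {t t' : ℕ} :
      s.reg x ≠ 0 → RamRuns p s s' t → RamRuns (.loop x p) s' s'' t' →
        RamRuns (.loop x p) s s'' (bitCost (s.reg x) + t + t')

/-- The machine is deterministic: final state and cost are determined by program and start. -/
theorem RamRuns.unique {p : RamProgram} {s s₁ s₂ : RamState} {t₁ t₂ : ℕ}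
    (h₁ : RamRuns p s s₁ t₁) (h₂ : RamRuns p s s₂ t₂) : s₁ = s₂ ∧ t₁ = t₂ := by
  induction h₁ generalizing s₂ t₂ with
  | seq _ _ ih₁ ih₂ =>
    cases h₂ with
    | seq g₁ g₂ =>
      obtain ⟨rfl, rfl⟩ := ih₁ g₁
      obtain ⟨rfl, rfl⟩ := ih₂ g₂
      exact ⟨rfl, rfl⟩
  | cond_pos hx _ ih =>
    cases h₂ with
    | cond_pos _ g =>
      obtain ⟨rfl, rfl⟩ := ih g
      exact ⟨rfl, rfl⟩
    | cond_zero hx' _ => exact absurd hx' hx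
  | cond_zero hx _ ih =>
    cases h₂ with
    | cond_pos hx' _ => exact absurd hx hx'
    | cond_zero _ g =>
      obtain ⟨rfl, rfl⟩ := ih g
      exact ⟨rfl, rfl⟩
  | loop_done hx =>
    cases h₂ with
    | loop_done _ => exact ⟨rfl, rfl⟩
    | loop_step hx' _ _ => exact absurd hx hx'
  | loop_step hx _ _ ih₁ ih₂ =>
    cases h₂ with
    | loop_done hx' => exact absurd hx' hx
    | loop_step _ g₁ g₂ =>
      obtain ⟨rfl, rfl⟩ := ih₁ g₁
      obtain ⟨rfl, rfl⟩ := ih₂ g₂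
      exact ⟨rfl, rfl⟩
  | _ => cases h₂; exact ⟨rfl, rfl⟩

/-! ### Input and output -/

namespace EnergyInstance

/-- The binary encoding length of an instance. -/
def inputSize (I : EnergyInstance) : ℕ :=
  bitCost I.n + ∑ ℓ, (bitCost (I.tAc ℓ) + bitCost (I.tBr ℓ))

/-- The initial memory: register `0` holds `n`, array `0` the acceleration times, array `1` the
braking times, and everything else is `0`. -/
def inputState (I : EnergyInstance) : RamState where
  reg x := if x = 0 then I.n else 0
  arr a i :=
    if h : i < I.n then
      if a = 0 then I.tAc ⟨i, h⟩ else if a = 1 then I.tBr ⟨i, h⟩ else 0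
    else 0

end EnergyInstance

/-- The number that stands for an event in the output: `2ℓ` for the arrival and `2ℓ + 1` for the
departure of line `ℓ`. -/
def StationEvent.code {n : ℕ} : StationEvent n → ℕ
  | StationEvent.arr ℓ => 2 * (ℓ : ℕ)
  | StationEvent.dep ℓ => 2 * (ℓ : ℕ) + 1

/-- The final memory `s` holds the path `P`: the codes of its vertices stand in order at the
beginning of array `2`. -/
def RamState.HoldsPath {n : ℕ} (s : RamState) (P : List (StationEvent n)) : Prop :=
  ∀ (i : ℕ) (h : i < P.length), s.arr 2 i = P[i].code

/-! ### A program logic for random access machines -/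

namespace RamState

/-! An admissible path serves the lines one after another. With one additional line whose times are
`0` it closes up to a cyclic permutation `τ` of `n + 1` lines, and the two new arcs have weight `0`.
For truncated subtraction `min a b + (a - b) = a`, so maximizing the weight means minimizing the sum
of the differences `tAc k - tBr (τ k)`. This is a travelling salesman problem of Gilmore–Gomory
type.

Sort both families of times into monotone `x` and `y`. Then `τ` becomes an assignment `π` of
positions, and `τ` is a single cycle iff `σ * π` is one, where `σ` sends the arrival position of a
line to its departure position. Counting for each level `θ` the `p` with `y (π p) ≤ θ < x p` shows
that `π` costs at least as much as the identity plus the gaps of all edges between consecutive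
positions that it crosses downwards (`cost_one_add_le`). For a tour these edges connect all cycles
of `σ` (`spans_crossed`), so a minimum spanning tree on these cycles gives a lower bound.

Kruskal's greedy method attains it. For an edge of least gap between different cycles, the
destinations of two suitable jumps, one on each side, are swapped. This merges the two cycles and
raises the cost by exactly the gap (`cost_exchange`), because `π` never crosses an edge that joins
different cycles. `MergeInv` carries the induction; its clause `opt` survives by the exchange
property of spanning trees (`Setoid.exists_exchange`).

For the running time, one step lengthens the numbers by at most one bit and costs at most linearly
in their length. So `m` steps from numbers of `B` bits cost at most `m * (2 * (B + m) + 2)`, and it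
suffices to bound the number of steps by a polynomial in `n`. `Wp` combines this count with
correctness and a frame condition. -/

@[simp] theorem setReg_reg (s : RamState) (x v y : ℕ) :
    (s.setReg x v).reg y = if y = x then v else s.reg y := by
  simp [setReg, Function.update_apply]

@[simp] theorem setReg_arr (s : RamState) (x v : ℕ) : (s.setReg x v).arr = s.arr := rfl

@[simp] theorem setArr_reg (s : RamState) (a i v : ℕ) : (s.setArr a i v).reg = s.reg := rfl

@[simp] theorem setArr_arr (s : RamState) (a i v b j : ℕ) :
    (s.setArr a i v).arr b j = if b = a ∧ j = i then v else s.arr b j := by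
  by_cases hb : b = a <;> by_cases hj : j = i <;> simp [setArr, hb, hj]

/-- All numbers in the memory have at most `B` bits. -/
def Bounded (s : RamState) (B : ℕ) : Prop :=
  (∀ x, Nat.size (s.reg x) ≤ B) ∧ ∀ a i, Nat.size (s.arr a i) ≤ B

theorem Bounded.mono {s : RamState} {B B' : ℕ} (h : s.Bounded B) (hB : B ≤ B') : s.Bounded B' :=
  ⟨fun x => (h.1 x).trans hB, fun a i => (h.2 a i).trans hB⟩

theorem Bounded.setReg {s : RamState} {B : ℕ} (h : s.Bounded B) (x : ℕ) {v : ℕ}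
    (hv : Nat.size v ≤ B) : (s.setReg x v).Bounded B := by
  refine ⟨fun y => ?_, h.2⟩
  rw [setReg_reg]
  split_ifs
  exacts [hv, h.1 y]

theorem Bounded.setArr {s : RamState} {B : ℕ} (h : s.Bounded B) (a i : ℕ) {v : ℕ}
    (hv : Nat.size v ≤ B) : (s.setArr a i v).Bounded B := by
  refine ⟨h.1, fun b j => ?_⟩
  rw [setArr_arr]
  split_ifs
  exacts [hv, h.2 b j]

end RamState

namespace RamProgram

/-- The registers that a program may write. -/
def writes : RamProgram → List ℕ
  | skip => []
  | const x _ => [x]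
  | add x _ _ => [x]
  | sub x _ _ => [x]
  | load x _ _ => [x]
  | store _ _ _ => []
  | seq p q => p.writes ++ q.writes
  | cond _ p q => p.writes ++ q.writes
  | loop _ p => p.writes

/-- The arrays that a program may write. -/
def writesArr : RamProgram → List ℕ
  | skip => []
  | const _ _ => []
  | add _ _ _ => []
  | sub _ _ _ => []
  | load _ _ _ => []
  | store a _ _ => [a]
  | seq p q => p.writesArr ++ q.writesArr
  | cond _ p q => p.writesArr ++ q.writesArr
  | loop _ p => p.writesArr

/-- The program contains no loop. -/
def loopFree : RamProgram → Bool
  | seq p q => p.loopFree && q.loopFree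
  | cond _ p q => p.loopFree && q.loopFree
  | loop _ _ => false
  | _ => true

/-- The effect of a program without loops. -/
def eval : RamProgram → RamState → RamState
  | skip, s => s
  | const x c, s => s.setReg x c
  | add x y z, s => s.setReg x (s.reg y + s.reg z)
  | sub x y z, s => s.setReg x (s.reg y - s.reg z)
  | load x a y, s => s.setReg x (s.arr a (s.reg y))
  | store a x y, s => s.setArr a (s.reg x) (s.reg y)
  | seq p q, s => q.eval (p.eval s)
  | cond x p q, s => if s.reg x ≠ 0 then p.eval s else q.eval s
  | loop _ _, s => s

/-- A bound for the number of steps of a program without loops. -/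
def steps : RamProgram → ℕ
  | skip => 1
  | const _ c => c + 1
  | add _ _ _ => 1
  | sub _ _ _ => 1
  | load _ _ _ => 1
  | store _ _ _ => 1
  | seq p q => p.steps + q.steps
  | cond _ p q => p.steps + q.steps + 1
  | loop _ _ => 0

/-- The program leaves everything outside of its write set unchanged. -/
def Frame (p : RamProgram) (s s' : RamState) : Prop :=
  (∀ x, x ∉ p.writes → s'.reg x = s.reg x) ∧ ∀ a, a ∉ p.writesArr → s'.arr a = s.arr a

/-- `p` leads from `s` to `s'` in at most `m` steps. A step adds at most one bit to the size of the
numbers, and its cost is bounded by that size. -/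
def Exec (p : RamProgram) (s s' : RamState) (m : ℕ) : Prop :=
  ∀ B, s.Bounded B → s'.Bounded (B + m) ∧ ∃ t, RamRuns p s s' t ∧ t ≤ m * (2 * (B + m) + 2)

theorem Exec.seq {p q : RamProgram} {s s' s'' : RamState} {m m' : ℕ} (h : p.Exec s s' m)
    (h' : q.Exec s' s'' m') : (RamProgram.seq p q).Exec s s'' (m + m') := by
  intro B hB
  obtain ⟨h₁, t, ht, htm⟩ := h B hB
  obtain ⟨h₂, t', ht', htm'⟩ := h' _ h₁
  refine ⟨h₂.mono (by omega), _, ht.seq ht', ?_⟩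
  -- The second program starts from numbers of `B + m` bits. Both costs are at most their step
  -- counts times the factor for `B + m + m'` bits.
  nlinarith [Nat.zero_le (m * m')]

theorem Exec.cond_pos {x : ℕ} {p q : RamProgram} {s s' : RamState} {m : ℕ} (hx : s.reg x ≠ 0)
    (h : p.Exec s s' m) : (cond x p q).Exec s s' (m + 1) := by
  intro B hB
  obtain ⟨h₁, t, ht, htm⟩ := h B hB
  refine ⟨h₁.mono (by omega), _, ht.cond_pos hx, ?_⟩
  have := hB.1 x
  rw [bitCost]
  nlinarith

theorem Exec.cond_zero {x : ℕ} {p q : RamProgram} {s s' : RamState} {m : ℕ} (hx : s.reg x = 0)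
    (h : q.Exec s s' m) : (cond x p q).Exec s s' (m + 1) := by
  intro B hB
  obtain ⟨h₁, t, ht, htm⟩ := h B hB
  refine ⟨h₁.mono (by omega), _, ht.cond_zero hx, ?_⟩
  have := hB.1 x
  rw [bitCost]
  nlinarith

theorem Exec.loop_done {x : ℕ} {p : RamProgram} {s : RamState} (hx : s.reg x = 0) :
    (loop x p).Exec s s 1 := by
  intro B hB
  refine ⟨hB.mono (by omega), _, .loop_done hx, ?_⟩
  have := hB.1 x
  rw [bitCost]
  omega

theorem Exec.loop_step {x : ℕ} {p : RamProgram} {s s' s'' : RamState} {m m' : ℕ}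
    (hx : s.reg x ≠ 0) (h : p.Exec s s' m) (h' : (loop x p).Exec s' s'' m') :
    (loop x p).Exec s s'' (m + 1 + m') := by
  intro B hB
  obtain ⟨h₁, t, ht, htm⟩ := h B hB
  obtain ⟨h₂, t', ht', htm'⟩ := h' _ h₁
  refine ⟨h₂.mono (by omega), _, ht.loop_step hx ht', ?_⟩
  have := hB.1 x
  rw [bitCost]
  nlinarith [Nat.zero_le (m * m')]

/-! ### Programs without loops -/

theorem size_add_le {a b B : ℕ} (ha : Nat.size a ≤ B) (hb : Nat.size b ≤ B) :
    Nat.size (a + b) ≤ B + 1 := by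
  rw [Nat.size_le] at *
  rw [pow_succ]
  omega

theorem size_sub_le {a b B : ℕ} (ha : Nat.size a ≤ B) : Nat.size (a - b) ≤ B :=
  (Nat.size_le_size (Nat.sub_le a b)).trans ha

theorem exec_eval {p : RamProgram} (hp : p.loopFree = true) (s : RamState) :
    p.Exec s (p.eval s) p.steps := by
  induction p generalizing s with
  | skip => exact fun B hB => ⟨hB.mono (by omega), _, .skip s, by rw [steps]; omega⟩
  | const x c =>
    intro B hB
    -- A constant may introduce up to `c` bits at once, hence the `c + 1` steps that it counts for.
    have hc : Nat.size c ≤ c := Nat.size_le.2 Nat.lt_two_pow_self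
    refine ⟨(hB.mono (by omega)).setReg x (by rw [steps]; omega), _, .const s x c, ?_⟩
    rw [bitCost, steps]
    nlinarith
  | add x y z =>
    intro B hB
    have hy := hB.1 y
    have hz := hB.1 z
    refine ⟨(hB.mono (by omega)).setReg x (size_add_le hy hz), _, .add s x y z, ?_⟩
    rw [bitCost, bitCost, steps]
    omega
  | sub x y z =>
    intro B hB
    have hy := hB.1 y
    have hz := hB.1 z
    refine ⟨(hB.mono (by omega)).setReg x ((size_sub_le hy).trans (by omega)), _, .sub s x y z, ?_⟩
    rw [bitCost, bitCost, steps]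
    omega
  | load x a y =>
    intro B hB
    have hy := hB.1 y
    have hz := hB.2 a (s.reg y)
    refine ⟨(hB.mono (by omega)).setReg x (hz.trans (by omega)), _, .load s x a y, ?_⟩
    rw [bitCost, bitCost, steps]
    omega
  | store a x y =>
    intro B hB
    have hy := hB.1 y
    have hx := hB.1 x
    refine ⟨(hB.mono (by omega)).setArr a _ (hy.trans (by omega)), _, .store s a x y, ?_⟩
    rw [bitCost, bitCost, steps]
    omega
  | seq p q ihp ihq =>
    simp only [loopFree, Bool.and_eq_true] at hp
    exact (ihp hp.1 s).seq (ihq hp.2 _)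
  | cond x p q ihp ihq =>
    simp only [loopFree, Bool.and_eq_true] at hp
    -- `steps` adds up both branches although only one is executed, so the count must be relaxed.
    have key : ∀ {m m' : ℕ} {r : RamProgram} {s s' : RamState}, m ≤ m' → r.Exec s s' m →
        r.Exec s s' m' := by
      intro m m' r s s' hm h B hB
      obtain ⟨h₁, t, ht, htm⟩ := h B hB
      exact ⟨h₁.mono (by omega), t, ht, htm.trans (by gcongr)⟩
    rw [eval, steps]
    split_ifs with hx
    · exact key (by omega) (Exec.cond_pos hx (ihp hp.1 s))
    · exact key (by omega) (Exec.cond_zero (not_not.1 hx) (ihq hp.2 s))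
  | loop x p => simp [loopFree] at hp

/-- Started in `s`, the program `p` halts within `T` steps in a state that satisfies `Q` and agrees
with `s` outside of the write set of `p`. -/
def Wp (p : RamProgram) (T : ℕ) (Q : RamState → Prop) (s : RamState) : Prop :=
  ∃ s' m, m ≤ T ∧ p.Exec s s' m ∧ p.Frame s s' ∧ Q s'

theorem Wp.mono {p : RamProgram} {T T' : ℕ} {Q Q' : RamState → Prop} {s : RamState}
    (h : p.Wp T Q s) (hT : T ≤ T') (hQ : ∀ s', p.Frame s s' → Q s' → Q' s') : p.Wp T' Q' s := by
  obtain ⟨s', m, hm, he, hf, hq⟩ := h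
  exact ⟨s', m, hm.trans hT, he, hf, hQ s' hf hq⟩

theorem Frame.seq {p q : RamProgram} {s s' s'' : RamState} (h : p.Frame s s')
    (h' : q.Frame s' s'') : (RamProgram.seq p q).Frame s s'' := by
  refine ⟨fun x hx => ?_, fun a ha => ?_⟩
  · simp only [writes, List.mem_append, not_or] at hx
    rw [h'.1 x hx.2, h.1 x hx.1]
  · simp only [writesArr, List.mem_append, not_or] at ha
    rw [h'.2 a ha.2, h.2 a ha.1]

theorem Wp.seq {p q : RamProgram} {T T' : ℕ} {Q : RamState → Prop} {s : RamState}
    (h : p.Wp T (q.Wp T' Q) s) : (RamProgram.seq p q).Wp (T + T') Q s := by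
  obtain ⟨s', m, hm, he, hf, s'', m', hm', he', hf', hq⟩ := h
  exact ⟨s'', m + m', by omega, he.seq he', hf.seq hf', hq⟩

theorem frame_eval {p : RamProgram} (hp : p.loopFree = true) (s : RamState) :
    p.Frame s (p.eval s) := by
  induction p generalizing s with
  | skip => exact ⟨fun _ _ => rfl, fun _ _ => rfl⟩
  | const | add | sub | load =>
    refine ⟨fun x hx => ?_, fun _ _ => rfl⟩
    have : ¬ x = _ := fun h => hx (by rw [writes, h]; exact List.mem_singleton_self _)
    simp [this, eval]
  | store a x y =>
    refine ⟨fun _ _ => rfl, fun b hb => ?_⟩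
    have : ¬ b = a := fun h => hb (by rw [writesArr, h]; exact List.mem_singleton_self _)
    ext j
    simp [this, eval]
  | seq p q ihp ihq =>
    simp only [loopFree, Bool.and_eq_true] at hp
    exact (ihp hp.1 s).seq (ihq hp.2 _)
  | cond x p q ihp ihq =>
    simp only [loopFree, Bool.and_eq_true] at hp
    rw [eval]
    refine ⟨fun y hy => ?_, fun a ha => ?_⟩
    · simp only [writes, List.mem_append, not_or] at hy
      split_ifs
      exacts [(ihp hp.1 s).1 y hy.1, (ihq hp.2 s).1 y hy.2]
    · simp only [writesArr, List.mem_append, not_or] at ha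
      split_ifs
      exacts [(ihp hp.1 s).2 a ha.1, (ihq hp.2 s).2 a ha.2]
  | loop x p => simp [loopFree] at hp

theorem wp_eval {p : RamProgram} (hp : p.loopFree = true) {Q : RamState → Prop} {s : RamState}
    (h : Q (p.eval s)) : p.Wp p.steps Q s :=
  ⟨_, _, le_rfl, exec_eval hp s, frame_eval hp s, h⟩

theorem wp_cond {x : ℕ} {p q : RamProgram} {T : ℕ} {Q : RamState → Prop} {s : RamState}
    (hp : s.reg x ≠ 0 → p.Wp T Q s) (hq : s.reg x = 0 → q.Wp T Q s) :
    (cond x p q).Wp (T + 1) Q s := by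
  by_cases hx : s.reg x = 0
  · obtain ⟨s', m, hm, he, hf, h⟩ := hq hx
    refine ⟨s', m + 1, by omega, Exec.cond_zero hx he, ⟨fun y hy => ?_, fun a ha => ?_⟩, h⟩
    · exact hf.1 y fun h => hy (List.mem_append_right _ h)
    · exact hf.2 a fun h => ha (List.mem_append_right _ h)
  · obtain ⟨s', m, hm, he, hf, h⟩ := hp hx
    refine ⟨s', m + 1, by omega, Exec.cond_pos hx he, ⟨fun y hy => ?_, fun a ha => ?_⟩, h⟩
    · exact hf.1 y fun h => hy (List.mem_append_left _ h)
    · exact hf.2 a fun h => ha (List.mem_append_left _ h)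

/-- Run `p` for all values of register `c` below its present value, in decreasing order.
Register `1` is supposed to hold `1`. -/
def forDown (c : ℕ) (p : RamProgram) : RamProgram :=
  loop c (seq (sub c c 1) p)

/-- `Inv k` describes the state in which exactly the values below `k` remain to be processed. The
counter is lowered before the body runs, so the invariant must survive this change (`hstab`). A
round takes two steps for test and decrement besides the body, and the final test takes one more. -/
theorem wp_forDown {c : ℕ} {p : RamProgram} {T m : ℕ} {s₀ : RamState} (Inv : ℕ → RamState → Prop)
    (hc : c ∉ p.writes) (h1 : 1 ∉ (forDown c p).writes) (hm : s₀.reg c = m) (hone : s₀.reg 1 = 1)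
    (hstab : ∀ k s, Inv k s → Inv k (s.setReg c (k - 1))) (hInv : Inv m s₀)
    (hstep : ∀ k < m, ∀ s, (forDown c p).Frame s₀ s → s.reg c = k → Inv (k + 1) s →
      p.Wp T (Inv k) s) :
    (forDown c p).Wp (m * (T + 2) + 1) (Inv 0) s₀ := by
  have main : ∀ k ≤ m, ∀ s, (forDown c p).Frame s₀ s → s.reg c = k → Inv k s →
      ∃ s' j, j ≤ k * (T + 2) + 1 ∧ (forDown c p).Exec s s' j ∧ (forDown c p).Frame s₀ s' ∧
        Inv 0 s' := by
    intro k
    induction k with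
    | zero => exact fun _ s hf hs hi => ⟨s, 1, by omega, Exec.loop_done hs, hf, hi⟩
    | succ k ih =>
      intro hk s hf hs hi
      have e : (sub c c 1).eval s = s.setReg c k := by
        rw [eval, hs, hf.1 1 h1, hone, Nat.add_sub_cancel]
      have hf₁ : (sub c c 1).Frame s (s.setReg c k) := e ▸ frame_eval (p := sub c c 1) rfl s
      have hf₂ : (forDown c p).Frame s₀ (s.setReg c k) := by
        refine ⟨fun x hx => ?_, fun a ha => ?_⟩
        · rw [hf₁.1 x (fun h => hx (List.mem_append_left _ h)), hf.1 x hx]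
        · rw [hf₁.2 a (fun h => ha (List.mem_append_left _ h)), hf.2 a ha]
      obtain ⟨s', j, hj, he, hf', hi'⟩ := hstep k (by omega) (s.setReg c k) hf₂ (by simp)
        (hstab _ _ hi)
      have hs' : s'.reg c = k := by rw [hf'.1 c hc]; simp
      have hf₃ : (forDown c p).Frame s₀ s' := by
        refine ⟨fun x hx => ?_, fun a ha => ?_⟩
        · rw [hf'.1 x (fun h => hx (List.mem_append_right _ h)), hf₂.1 x hx]
        · rw [hf'.2 a (fun h => ha (List.mem_append_right _ h)), hf₂.2 a ha]
      obtain ⟨s'', j', hj', he', hf'', hi''⟩ := ih (by omega) s' hf₃ hs' hi'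
      have e₁ : (sub c c 1).Exec s (s.setReg c k) 1 := e ▸ exec_eval (p := sub c c 1) rfl s
      refine ⟨s'', 1 + j + 1 + j', ?_, (Exec.loop_step (by omega) (e₁.seq he) he'), hf'', hi''⟩
      rw [add_mul, one_mul]
      omega
  obtain ⟨s', j, hj, he, hf, hi⟩ := main m le_rfl s₀ ⟨fun _ _ => rfl, fun _ _ => rfl⟩ hm hInv
  exact ⟨s', j, hj, he, hf, hi⟩

end RamProgram

/-! ### Merging cycles of a permutation -/

namespace Equiv.Perm

variable {α : Type*} [Finite α]

/-- The equivalence relation of lying on a common cycle. -/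
abbrev cycleRel (f : Perm α) : Setoid α := SameCycle.setoid f

/-- On a finite type natural powers suffice to reach every point of a cycle, so forward invariance
is enough. -/
theorem SameCycle.mem_of_mapsTo {f : Perm α} {X : Set α} (hX : ∀ z ∈ X, f z ∈ X) {x y : α}
    (h : f.SameCycle x y) (hx : x ∈ X) : y ∈ X := by
  obtain ⟨i, rfl⟩ := h.exists_nat_pow_eq
  induction i with
  | zero => exact hx
  | succ i ih =>
    rw [pow_succ', mul_apply]
    exact hX _ (ih ⟨i, by simp⟩)

variable [DecidableEq α]

/-- The product sends `u` to `f v` and then follows the cycle of `v` under `f`, which avoids `u`,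
until it arrives at `v`. -/
theorem sameCycle_mul_swap_self {f : Perm α} {u v : α} (h : ¬ f.SameCycle u v) :
    (f * swap u v).SameCycle u v := by
  by_contra hg
  have key : ∀ i : ℕ, (f * swap u v).SameCycle u ((f ^ (i + 1)) v) := by
    intro i
    induction i with
    | zero => exact ⟨1, by simp⟩
    | succ i ih =>
      have hu : (f ^ (i + 1)) v ≠ u := fun e => h (SameCycle.symm ⟨(i + 1 : ℕ), by
        rw [zpow_natCast, e]⟩)
      have hv : (f ^ (i + 1)) v ≠ v := fun e => hg (by rwa [e] at ih)
      have : (f ^ (i + 1 + 1)) v = (f * swap u v) ((f ^ (i + 1)) v) := by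
        rw [pow_succ', mul_apply, mul_apply, swap_apply_of_ne_of_ne hu hv]
      rw [this]
      exact sameCycle_apply_right.2 ih
  have := key (orderOf f - 1)
  rw [Nat.sub_add_cancel (orderOf_pos f), pow_orderOf_eq_one] at this
  exact hg this

/-- Multiplication with a transposition of points on different cycles joins the two cycles. -/
theorem SameCycle.mul_swap {f : Perm α} {u v x y : α} (h : ¬ f.SameCycle u v)
    (hxy : f.SameCycle x y) : (f * swap u v).SameCycle x y := by
  refine SameCycle.mem_of_mapsTo (X := {z | (f * swap u v).SameCycle x z}) (fun z hz => ?_) hxy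
    (SameCycle.refl _ x)
  have huv := sameCycle_mul_swap_self h
  -- The product maps `swap u v z` to `f z`, so it is enough that the swap stays within the cycle.
  have hz' : (f * swap u v).SameCycle x (swap u v z) := by
    rcases eq_or_ne z u with rfl | hu
    · rw [swap_apply_left]
      exact hz.trans huv
    rcases eq_or_ne z v with rfl | hv
    · rw [swap_apply_right]
      exact hz.trans huv.symm
    · rwa [swap_apply_of_ne_of_ne hu hv]
  have := sameCycle_apply_right.2 hz'
  rwa [mul_apply, swap_apply_self] at this

theorem SameCycle.exists_pow_le_card {β : Type*} [Fintype β] [DecidableEq β] {f : Perm β} {x y : β}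
    (h : f.SameCycle x y) (hne : x ≠ y) :
    ∃ i, 1 ≤ i ∧ i ≤ Fintype.card β ∧ (f ^ i) x = y := by
  have hx : x ∈ f.support := mem_support.2 fun e => hne (h.eq_of_left e)
  obtain ⟨i, hi, rfl⟩ := h.exists_pow_eq_of_mem_support hx
  refine ⟨i, Nat.one_le_iff_ne_zero.2 fun e => hne (by simp [e]), ?_, Eq.refl _⟩
  exact hi.le.trans (Finset.card_le_univ _)

end Equiv.Perm

/-! ### Exchange of edges -/

namespace Setoid

variable {α : Type*}

/-- The equivalence relation that arises from `E` by joining the classes of `u` and `v`. -/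
def addEdge (E : Setoid α) (u v : α) : Setoid α where
  r x y := E x y ∨ (E x u ∧ E v y) ∨ (E x v ∧ E u y)
  iseqv :=
    { refl := fun x => .inl (E.refl x)
      symm := by
        rintro x y (h | ⟨h, h'⟩ | ⟨h, h'⟩)
        · exact .inl (E.symm h)
        · exact .inr (.inr ⟨E.symm h', E.symm h⟩)
        · exact .inr (.inl ⟨E.symm h', E.symm h⟩)
      trans := by
        rintro x y z (h | ⟨h, h'⟩ | ⟨h, h'⟩) (k | ⟨k, k'⟩ | ⟨k, k'⟩)
        · exact .inl (E.trans h k)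
        · exact .inr (.inl ⟨E.trans h k, k'⟩)
        · exact .inr (.inr ⟨E.trans h k, k'⟩)
        · exact .inr (.inl ⟨h, E.trans h' k⟩)
        · exact .inr (.inl ⟨h, k'⟩)
        · exact .inl (E.trans h k')
        · exact .inr (.inr ⟨h, E.trans h' k⟩)
        · exact .inl (E.trans h k')
        · exact .inr (.inr ⟨h, k'⟩) }

theorem le_addEdge (E : Setoid α) (u v : α) : E ≤ E.addEdge u v := fun _ _ h => .inl h

theorem addEdge_self (E : Setoid α) (u v : α) : E.addEdge u v u v :=
  .inr (.inl ⟨E.refl u, E.refl v⟩)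

theorem addEdge_le {E F : Setoid α} {u v : α} (h : E ≤ F) (huv : F u v) : E.addEdge u v ≤ F := by
  rintro x y (k | ⟨k, l⟩ | ⟨k, l⟩)
  · exact h k
  · exact F.trans (h k) (F.trans huv (h l))
  · exact F.trans (h k) (F.trans (F.symm huv) (h l))

/-- An edge set that connects `u` and `v` over `E` contains an edge that may be replaced by the
edge from `u` to `v`. -/
theorem exists_exchange {ι : Type*} [DecidableEq ι] (s t : ι → α) (C : Finset ι) (E : Setoid α)
    {u v : α} (huv : ¬ E u v)
    (h : ∀ F : Setoid α, E ≤ F → (∀ i ∈ C, F (s i) (t i)) → F u v) :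
    ∃ i ∈ C, ¬ E (s i) (t i) ∧ ∀ F : Setoid α, E ≤ F → F u v →
      (∀ j ∈ C.erase i, F (s j) (t j)) → F (s i) (t i) := by
  induction C using Finset.induction_on generalizing E with
  | empty => exact absurd (h E le_rfl (by simp)) huv
  | insert i C hi ih =>
    -- The edges of `C` are added to `E` one at a time; the edge that first connects `u` and `v` is
    -- the one to be replaced.
    by_cases he : E.addEdge (s i) (t i) u v
    · refine ⟨i, Finset.mem_insert_self _ _, fun hE => huv (addEdge_le le_rfl hE he), ?_⟩
      intro F hF hFuv _
      rcases he with k | ⟨k, k'⟩ | ⟨k, k'⟩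
      · exact absurd k huv
      · exact F.trans (F.symm (hF k)) (F.trans hFuv (F.symm (hF k')))
      · exact F.trans (hF k') (F.trans (F.symm hFuv) (hF k))
    · obtain ⟨j, hj, hne, hx⟩ := ih (E.addEdge (s i) (t i)) he fun F hF hC =>
        h F ((le_addEdge _ _ _).trans hF) fun k hk => by
          rcases Finset.mem_insert.1 hk with rfl | hk
          · exact hF (addEdge_self _ _ _)
          · exact hC k hk
      have hij : i ≠ j := fun e => hi (e ▸ hj)
      refine ⟨j, Finset.mem_insert_of_mem hj, fun hE => hne (le_addEdge _ _ _ hE), ?_⟩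
      intro F hF hFuv hC
      refine hx F (addEdge_le hF (hC i ?_)) hFuv fun k hk => hC k ?_
      · exact Finset.mem_erase.2 ⟨hij, Finset.mem_insert_self _ _⟩
      · exact Finset.mem_erase.2 ⟨Finset.ne_of_mem_erase hk,
          Finset.mem_insert_of_mem (Finset.mem_of_mem_erase hk)⟩

end Setoid

/-! ### Cheapest tours on sorted data -/

namespace SortedTour

open Equiv Equiv.Perm

variable {n : ℕ} (x y : Fin (n + 1) → ℕ)

/-- The cost of the assignment `π` of departure positions to arrival positions. -/
def cost (π : Perm (Fin (n + 1))) : ℕ := ∑ p, (x p - y (π p))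

/-- The distance between the intervals at consecutive positions. -/
def gap (i : Fin n) : ℕ :=
  min (x i.succ) (y i.succ) - max (x i.castSucc) (y i.castSucc)

/-- The positions `i` such that the assignment `π` crosses from above `i` to below. -/
def crossed (π : Perm (Fin (n + 1))) : Finset (Fin n) :=
  {i | ∃ p, i.castSucc < p ∧ π p ≤ i.castSucc}

/-! ### The spanning tree lower bound -/

theorem tsub_eq_sum_range {Θ a : ℕ} (ha : a ≤ Θ) (b : ℕ) :
    a - b = ∑ θ ∈ Finset.range Θ, if b ≤ θ ∧ θ < a then 1 else 0 := by
  rw [Finset.sum_boole, ← Nat.card_Ico]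
  simp only [Nat.cast_id]
  congr 1
  ext θ
  simp only [Finset.mem_Ico, Finset.mem_filter, Finset.mem_range]
  omega

/-- An injection of the finite upper part into itself is onto; so without a crossing downwards there
is none upwards. -/
theorem le_castSucc_iff_of_notMem_crossed {π : Perm (Fin (n + 1))} {i : Fin n}
    (hi : i ∉ crossed π) (p : Fin (n + 1)) : π p ≤ i.castSucc ↔ p ≤ i.castSucc := by
  have h : ∀ q, i.castSucc < q → i.castSucc < π q := by
    intro q hq
    by_contra hq'
    exact hi (Finset.mem_filter.2 ⟨Finset.mem_univ _, q, hq, not_lt.1 hq'⟩)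
  constructor
  · intro hp
    by_contra hp'
    exact absurd (h p (not_le.1 hp')) (not_lt.2 hp)
  · intro hp
    by_contra hp'
    have := SameCycle.mem_of_mapsTo (X := Set.Ioi i.castSucc) (fun q hq => h q hq)
      (sameCycle_apply_left.2 (SameCycle.refl π p)) (not_le.1 hp')
    exact absurd this (not_lt.2 hp)

variable {x y}

/-- If `θ` lies in the gap of a crossed edge, that edge is unique, the identity contributes nothing
at this level because all `x` below the edge are at most `θ` and all `y` above it exceed `θ`, and
the crossing jump contributes to the right side. Otherwise only the identity and `π` are to be
compared. -/
theorem sum_threshold_le (hx : Monotone x) (hy : Monotone y) (π : Perm (Fin (n + 1))) (θ : ℕ) :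
    (∑ p, if y p ≤ θ ∧ θ < x p then 1 else 0) +
      (∑ i ∈ crossed π, if max (x i.castSucc) (y i.castSucc) ≤ θ ∧
        θ < min (x i.succ) (y i.succ) then 1 else 0) ≤
      ∑ p, if y (π p) ≤ θ ∧ θ < x p then 1 else 0 := by
  simp only [Finset.sum_boole, Nat.cast_id]
  by_cases hex : ∃ i ∈ crossed π, max (x i.castSucc) (y i.castSucc) ≤ θ ∧
      θ < min (x i.succ) (y i.succ)
  · obtain ⟨i, hi, h₁, h₂⟩ := hex
    rw [max_le_iff] at h₁
    rw [lt_min_iff] at h₂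
    have hlow : ∀ p, p ≤ i.castSucc ∨ i.succ ≤ p := fun p => by
      rcases le_or_gt p i.castSucc with h | h
      · exact .inl h
      · exact .inr (Fin.castSucc_lt_iff_succ_le.1 h)
    have e₁ : (Finset.univ.filter fun p => y p ≤ θ ∧ θ < x p) = ∅ := by
      refine Finset.filter_eq_empty_iff.2 fun p _ hp => ?_
      rcases hlow p with h | h
      · have := hx h
        omega
      · have := hy h
        omega
    have e₂ : ((crossed π).filter fun j => max (x j.castSucc) (y j.castSucc) ≤ θ ∧
        θ < min (x j.succ) (y j.succ)).card ≤ 1 := by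
      refine Finset.card_le_one.2 ?_
      have : ∀ j ∈ (crossed π).filter (fun j => max (x j.castSucc) (y j.castSucc) ≤ θ ∧
        θ < min (x j.succ) (y j.succ)), j = i := by
        intro j hj
        obtain ⟨-, h₃, h₄⟩ := Finset.mem_filter.1 hj
        rw [max_le_iff] at h₃
        rw [lt_min_iff] at h₄
        rcases lt_trichotomy j i with h | h | h
        · have := hx (show j.succ ≤ i.castSucc from Fin.castSucc_lt_iff_succ_le.1 (by simpa using h))
          omega
        · exact h
        · have := hx (show i.succ ≤ j.castSucc from Fin.castSucc_lt_iff_succ_le.1 (by simpa using h))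
          omega
      exact fun j hj k hk => (this j hj).trans (this k hk).symm
    obtain ⟨p, hp, hp'⟩ := (Finset.mem_filter.1 hi).2
    have e₃ : 0 < (Finset.univ.filter fun p => y (π p) ≤ θ ∧ θ < x p).card := by
      refine Finset.card_pos.2 ⟨p, Finset.mem_filter.2 ⟨Finset.mem_univ _, ?_, ?_⟩⟩
      · exact (hy hp').trans h₁.2
      · exact h₂.1.trans_le (hx (Fin.castSucc_lt_iff_succ_le.1 hp))
    rw [e₁, Finset.card_empty]
    omega
  · push Not at hex
    have e : ((crossed π).filter fun j => max (x j.castSucc) (y j.castSucc) ≤ θ ∧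
        θ < min (x j.succ) (y j.succ)) = ∅ :=
      Finset.filter_eq_empty_iff.2 fun i hi h => absurd h.2 (not_lt.2 (hex i hi h.1))
    rw [e, Finset.card_empty, add_zero]
    -- Such a `q` forces `x p ≤ θ → y p ≤ θ`. The identity then contributes the number of `y` up to
    -- `θ` minus the number of `x` up to `θ`, and no assignment contributes less.
    by_cases hYX : ∃ q, y q ≤ θ ∧ θ < x q
    · obtain ⟨q, hq, hq'⟩ := hYX
      have hXY : ∀ p, x p ≤ θ → y p ≤ θ := fun p hp => by
        rcases le_total p q with h | h
        · exact (hy h).trans hq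
        · have := hx h
          omega
      have c₁ : (Finset.univ.filter fun p => y p ≤ θ).card =
          (Finset.univ.filter fun p => y (π p) ≤ θ).card :=
        (Finset.card_bij (fun p _ => π p) (by simp) (fun _ _ _ _ h => π.injective h)
          (fun p hp => ⟨π⁻¹ p, by simpa using hp, by simp⟩)).symm
      have c₂ := Finset.card_filter_add_card_filter_not
        (s := Finset.univ.filter fun p => y p ≤ θ) (fun p => x p ≤ θ)
      have c₃ := Finset.card_filter_add_card_filter_not
        (s := Finset.univ.filter fun p => y (π p) ≤ θ) (fun p => x p ≤ θ)
      simp only [Finset.filter_filter, not_le] at c₂ c₃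
      have c₄ : (Finset.univ.filter fun p => y (π p) ≤ θ ∧ x p ≤ θ).card ≤
          (Finset.univ.filter fun p => y p ≤ θ ∧ x p ≤ θ).card :=
        Finset.card_le_card fun p hp => by
          simp only [Finset.mem_filter, Finset.mem_univ, true_and] at hp ⊢
          exact ⟨hXY p hp.2, hp.2⟩
      omega
    · push Not at hYX
      rw [Finset.filter_eq_empty_iff.2 (fun p _ h => absurd h.2 (not_lt.2 (hYX p h.1))),
        Finset.card_empty]
      exact Nat.zero_le _

theorem cost_one_add_le (hx : Monotone x) (hy : Monotone y) (π : Perm (Fin (n + 1))) :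
    cost x y 1 + ∑ i ∈ crossed π, gap x y i ≤ cost x y π := by
  have hΘ : ∀ p, x p ≤ x (Fin.last n) := fun p => hx (Fin.le_last p)
  have e : ∀ π' : Perm (Fin (n + 1)), cost x y π' = ∑ θ ∈ Finset.range (x (Fin.last n)),
      ∑ p, if y (π' p) ≤ θ ∧ θ < x p then 1 else 0 := fun π' => by
    rw [Finset.sum_comm]
    exact Finset.sum_congr rfl fun p _ => tsub_eq_sum_range (hΘ p) _
  have e' : ∑ i ∈ crossed π, gap x y i = ∑ θ ∈ Finset.range (x (Fin.last n)),
      ∑ i ∈ crossed π, if max (x i.castSucc) (y i.castSucc) ≤ θ ∧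
        θ < min (x i.succ) (y i.succ) then 1 else 0 := by
    rw [Finset.sum_comm]
    exact Finset.sum_congr rfl fun i _ =>
      tsub_eq_sum_range ((min_le_left _ _).trans (hΘ i.succ)) _
  rw [e, e, e', ← Finset.sum_add_distrib]
  exact Finset.sum_le_sum fun θ _ => sum_threshold_le hx hy π θ

/-- The edges in `C`, which join consecutive positions, connect all classes of `E`. -/
def Spans (E : Setoid (Fin (n + 1))) (C : Finset (Fin n)) : Prop :=
  ∀ F : Setoid (Fin (n + 1)), E ≤ F → (∀ i ∈ C, F i.castSucc i.succ) → ∀ p q, F p q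

theorem rel_of_between {F : Setoid (Fin (n + 1))} {p q : Fin (n + 1)} (hpq : p ≤ q)
    (h : ∀ i : Fin n, p ≤ i.castSucc → i.castSucc < q → F i.castSucc i.succ) : F p q := by
  induction q using Fin.induction with
  | zero =>
    rw [Fin.le_zero_iff.1 hpq]
  | succ i ih =>
    rcases hpq.eq_or_lt with rfl | hlt
    · exact F.refl _
    · have hle : p ≤ i.castSucc := Fin.le_castSucc_iff.2 hlt
      exact F.trans (ih hle fun j hj hj' => h j hj (hj'.trans (Fin.castSucc_lt_succ)))
        (h i hle Fin.castSucc_lt_succ)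

/-- A downward jump crosses every edge between its ends. An upward jump passes only edges that some
other jump crosses downwards. Hence `p` and `π p` are always connected, and applying `σ` stays
within a class. -/
theorem spans_crossed {σ π : Perm (Fin (n + 1))} (h : ∀ p q, (σ * π).SameCycle p q) :
    Spans (cycleRel σ) (crossed π) := by
  intro F hF hC p q
  have hstep : ∀ p, F p (π p) := by
    intro p
    rcases le_total p (π p) with hp | hp
    · refine rel_of_between hp fun i hi hi' => hC i ?_
      by_contra hn
      exact absurd ((le_castSucc_iff_of_notMem_crossed hn p).2 hi) (not_le.2 hi')
    · refine F.symm (rel_of_between hp fun i hi hi' => hC i ?_)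
      exact Finset.mem_filter.2 ⟨Finset.mem_univ _, p, hi', hi⟩
  refine SameCycle.mem_of_mapsTo (X := {z | F p z}) (fun z hz => ?_) (h p q) (F.refl p)
  exact F.trans hz (F.trans (hstep z) (hF (sameCycle_apply_right.2 (SameCycle.refl σ _))))

/-! ### Greedy merging along edges of least gap -/

variable (x y)

/-- The state of affairs while cycles are being merged: the assignment `π` crosses only between
positions on the same cycle, and it can be completed to a tour at least as cheap as any other. -/
structure MergeInv (σ π : Perm (Fin (n + 1))) : Prop where
  same : ∀ p, (σ * π).SameCycle p (σ p)
  sep : ∀ i : Fin n, ¬ (σ * π).SameCycle i.castSucc i.succ →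
    ∀ p, π p ≤ i.castSucc ↔ p ≤ i.castSucc
  opt : ∀ π' : Perm (Fin (n + 1)), (∀ p q, (σ * π').SameCycle p q) → ∃ C : Finset (Fin n),
    cost x y π + ∑ i ∈ C, gap x y i ≤ cost x y π' ∧ Spans (cycleRel (σ * π)) C

/-- The edges that may still be chosen. -/
def openEdges (σ π : Perm (Fin (n + 1))) : Finset (Fin n) :=
  {i | ¬ (σ * π).SameCycle i.castSucc i.succ}

/-- The jump below the edge `i` that takes part in the exchange at `i`. -/
def lowJump (π : Perm (Fin (n + 1))) (i : Fin n) : Fin (n + 1) :=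
  if x i.castSucc ≤ y i.castSucc then π⁻¹ i.castSucc else i.castSucc

/-- The jump above the edge `i` that takes part in the exchange at `i`. -/
def highJump (π : Perm (Fin (n + 1))) (i : Fin n) : Fin (n + 1) :=
  if x i.succ ≤ y i.succ then i.succ else π⁻¹ i.succ

/-- The assignment after the exchange at the edge `i`. -/
def exchange (π : Perm (Fin (n + 1))) (i : Fin n) : Perm (Fin (n + 1)) :=
  π * swap (lowJump x y π i) (highJump x y π i)

variable {x y}

theorem mergeInv_one (hx : Monotone x) (hy : Monotone y) (σ : Perm (Fin (n + 1))) :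
    MergeInv x y σ 1 where
  same p := by
    rw [mul_one]
    exact sameCycle_apply_right.2 (SameCycle.refl σ p)
  sep i _ p := Iff.rfl
  opt π' h := ⟨crossed π', cost_one_add_le hx hy π', by
    rw [mul_one]
    exact spans_crossed h⟩

theorem cost_mul_swap (π : Perm (Fin (n + 1))) {k l : Fin (n + 1)} (hkl : k ≠ l) :
    cost x y (π * swap k l) + ((x k - y (π k)) + (x l - y (π l))) =
      cost x y π + ((x k - y (π l)) + (x l - y (π k))) := by
  have h : ∀ f : Fin (n + 1) → ℕ, ∑ p, f p = f k + f l + ∑ p ∈ {k, l}ᶜ, f p := by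
    intro f
    rw [← Finset.sum_pair hkl, Finset.sum_add_sum_compl]
  have e : ∑ p ∈ {k, l}ᶜ, (x p - y ((π * swap k l) p)) = ∑ p ∈ {k, l}ᶜ, (x p - y (π p)) := by
    refine Finset.sum_congr rfl fun p hp => ?_
    simp only [Finset.mem_compl, Finset.mem_insert, Finset.mem_singleton, not_or] at hp
    rw [mul_apply, swap_apply_of_ne_of_ne hp.1 hp.2]
  rw [cost, cost, h, h (fun p => x p - y (π p)), e]
  simp only [mul_apply, swap_apply_left, swap_apply_right]
  omega

/-- The low jump has the larger of the two values at `i.castSucc` as an end, the high jump the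
smaller of the two values at `i.succ`. As `π` does not cross `i`, the other ends lie on the outer
sides, and the swap adds just the stretch between these two values. -/
theorem cost_exchange (hx : Monotone x) (hy : Monotone y) {π : Perm (Fin (n + 1))} {i : Fin n}
    (hi : ∀ p, π p ≤ i.castSucc ↔ p ≤ i.castSucc) :
    cost x y (exchange x y π i) = cost x y π + gap x y i := by
  have hlt : i.castSucc < i.succ := Fin.castSucc_lt_succ
  have hx' := hx hlt.le
  have hy' := hy hlt.le
  have hi' : ∀ p, i.succ ≤ π p ↔ i.succ ≤ p := fun p => by
    rw [← Fin.castSucc_lt_iff_succ_le, ← Fin.castSucc_lt_iff_succ_le, ← not_le, ← not_le, hi]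
  have a₁ := hx ((hi (π⁻¹ i.castSucc)).1 (by simp))
  have a₂ := hy ((hi i.castSucc).2 le_rfl)
  have a₃ := hx ((hi' (π⁻¹ i.succ)).1 (by simp))
  have a₄ := hy ((hi' i.succ).2 le_rfl)
  have b₁ : lowJump x y π i ≤ i.castSucc := by
    rw [lowJump]
    split_ifs
    exacts [(hi _).1 (by simp), le_rfl]
  have b₂ : i.succ ≤ highJump x y π i := by
    rw [highJump]
    split_ifs
    exacts [le_rfl, (hi' _).1 (by simp)]
  have key := cost_mul_swap (x := x) (y := y) π (b₁.trans_lt (hlt.trans_le b₂)).ne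
  rw [exchange]
  revert key
  generalize cost x y (π * swap (lowJump x y π i) (highJump x y π i)) = c
  rw [lowJump, highJump, gap]
  have hinv : ∀ q, π (π⁻¹ q) = q := fun q => by simp
  split_ifs with h₁ h₂ h₂ <;> (try simp only [hinv]) <;> omega

/-- `σ * π` sends `π⁻¹ p` to `σ p`, which `same` keeps on the cycle of `p`. So a jump may be
selected by its source or by its destination. -/
theorem MergeInv.sameCycle_inv {σ π : Perm (Fin (n + 1))} (h : MergeInv x y σ π)
    (p : Fin (n + 1)) : (σ * π).SameCycle (π⁻¹ p) p := by
  have h₁ := h.same p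
  have h₂ : (σ * π).SameCycle (π⁻¹ p) (σ p) := ⟨1, by simp⟩
  exact h₂.trans h₁.symm

theorem MergeInv.sameCycle_lowJump {σ π : Perm (Fin (n + 1))} (h : MergeInv x y σ π) (i : Fin n) :
    (σ * π).SameCycle (lowJump x y π i) i.castSucc := by
  rw [lowJump]
  split_ifs
  exacts [h.sameCycle_inv _, SameCycle.refl _ _]

theorem MergeInv.sameCycle_highJump {σ π : Perm (Fin (n + 1))} (h : MergeInv x y σ π) (i : Fin n) :
    (σ * π).SameCycle (highJump x y π i) i.succ := by
  rw [highJump]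
  split_ifs
  exacts [SameCycle.refl _ _, h.sameCycle_inv _]

theorem MergeInv.not_sameCycle_jump {σ π : Perm (Fin (n + 1))} (h : MergeInv x y σ π) {i : Fin n}
    (hi : i ∈ openEdges σ π) : ¬ (σ * π).SameCycle (lowJump x y π i) (highJump x y π i) :=
  fun hs => (Finset.mem_filter.1 hi).2
    ((h.sameCycle_lowJump i).symm.trans (hs.trans (h.sameCycle_highJump i)))

theorem MergeInv.sameCycle_exchange {σ π : Perm (Fin (n + 1))} (h : MergeInv x y σ π) {i : Fin n}
    (hi : i ∈ openEdges σ π) {p q : Fin (n + 1)} (hpq : (σ * π).SameCycle p q) :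
    (σ * exchange x y π i).SameCycle p q := by
  rw [exchange, ← mul_assoc]
  exact hpq.mul_swap (h.not_sameCycle_jump hi)

theorem MergeInv.sameCycle_exchange_self {σ π : Perm (Fin (n + 1))} (h : MergeInv x y σ π)
    {i : Fin n} (hi : i ∈ openEdges σ π) :
    (σ * exchange x y π i).SameCycle i.castSucc i.succ := by
  have := sameCycle_mul_swap_self (h.not_sameCycle_jump hi)
  rw [mul_assoc] at this
  exact (h.sameCycle_exchange hi (h.sameCycle_lowJump i).symm).trans
    (this.trans (h.sameCycle_exchange hi (h.sameCycle_highJump i)))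

theorem MergeInv.card_openEdges_exchange {σ π : Perm (Fin (n + 1))} (h : MergeInv x y σ π)
    {i : Fin n} (hi : i ∈ openEdges σ π) :
    (openEdges σ (exchange x y π i)).card < (openEdges σ π).card := by
  refine Finset.card_lt_card ⟨fun j hj => ?_, fun hs => ?_⟩
  · refine Finset.mem_filter.2 ⟨Finset.mem_univ _, fun hj' => ?_⟩
    exact (Finset.mem_filter.1 hj).2 (h.sameCycle_exchange hi hj')
  · exact (Finset.mem_filter.1 (hs hi)).2 (h.sameCycle_exchange_self hi)

theorem MergeInv.exchange (hx : Monotone x) (hy : Monotone y) {σ π : Perm (Fin (n + 1))}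
    (h : MergeInv x y σ π) {i : Fin n} (hi : i ∈ openEdges σ π)
    (hmin : ∀ j ∈ openEdges σ π, gap x y i ≤ gap x y j) :
    MergeInv x y σ (exchange x y π i) where
  same p := h.sameCycle_exchange hi (h.same p)
  sep j hj p := by
    have hji : j ≠ i := by
      rintro rfl
      exact hj (h.sameCycle_exchange_self hi)
    have hj' : ∀ p, π p ≤ j.castSucc ↔ p ≤ j.castSucc :=
      h.sep j fun hs => hj (h.sameCycle_exchange hi hs)
    have hinv : ∀ p, π⁻¹ p ≤ j.castSucc ↔ p ≤ j.castSucc := fun p => by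
      rw [← hj', show π (π⁻¹ p) = p by simp]
    -- The two jumps lie on the same sides of `j` as the two ends of `i`, and these are not
    -- separated by `j ≠ i`. So the swap creates no crossing at `j`.
    have hlow : lowJump x y π i ≤ j.castSucc ↔ i.castSucc ≤ j.castSucc := by
      rw [lowJump]
      split_ifs
      exacts [hinv _, Iff.rfl]
    have hhigh : highJump x y π i ≤ j.castSucc ↔ i.succ ≤ j.castSucc := by
      rw [highJump]
      split_ifs
      exacts [Iff.rfl, hinv _]
    have hiff : i.castSucc ≤ j.castSucc ↔ i.succ ≤ j.castSucc := by
      rw [← Fin.castSucc_lt_iff_succ_le]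
      exact ⟨fun h => h.lt_of_ne fun e => hji (Fin.castSucc_injective _ e).symm, le_of_lt⟩
    rw [SortedTour.exchange, mul_apply, hj']
    rcases eq_or_ne p (lowJump x y π i) with rfl | h₁
    · rw [swap_apply_left, hlow, hhigh, hiff]
    rcases eq_or_ne p (highJump x y π i) with rfl | h₂
    · rw [swap_apply_right, hlow, hhigh, hiff]
    · rw [swap_apply_of_ne_of_ne h₁ h₂]
  opt π' hπ' := by
    obtain ⟨C, hC, hS⟩ := h.opt π' hπ'
    have hi' := (Finset.mem_filter.1 hi).2
    -- Some edge `j` of `C` can be traded for `i`. It joins different cycles, so its gap is at least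
    -- that of `i`.
    obtain ⟨j, hj, hne, hF⟩ := Setoid.exists_exchange Fin.castSucc Fin.succ C (cycleRel (σ * π))
      hi' fun F hF hFC => hS F hF hFC _ _
    refine ⟨C.erase j, ?_, ?_⟩
    · have := hmin j (Finset.mem_filter.2 ⟨Finset.mem_univ _, hne⟩)
      rw [cost_exchange hx hy (h.sep i hi')]
      rw [← Finset.add_sum_erase C _ hj] at hC
      omega
    · intro F hle hFC p q
      have hle' : cycleRel (σ * π) ≤ F := fun p q hpq => hle (h.sameCycle_exchange hi hpq)
      refine hS F hle' (fun k hk => ?_) p q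
      rcases eq_or_ne k j with rfl | hkj
      · exact hF F hle' (hle (h.sameCycle_exchange_self hi)) hFC
      · exact hFC k (Finset.mem_erase.2 ⟨hkj, hk⟩)

theorem sameCycle_of_openEdges_eq_empty {σ π : Perm (Fin (n + 1))} (h : openEdges σ π = ∅)
    (p q : Fin (n + 1)) : (σ * π).SameCycle p q := by
  have hi : ∀ i : Fin n, cycleRel (σ * π) i.castSucc i.succ := fun i => by
    by_contra hn
    have : i ∈ openEdges σ π := Finset.mem_filter.2 ⟨Finset.mem_univ _, hn⟩
    simp [h] at this
  rcases le_total p q with hpq | hpq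
  · exact rel_of_between hpq fun i _ _ => hi i
  · exact (cycleRel (σ * π)).symm (rel_of_between hpq fun i _ _ => hi i)

theorem MergeInv.cost_le {σ π : Perm (Fin (n + 1))} (h : MergeInv x y σ π)
    {π' : Perm (Fin (n + 1))} (hπ' : ∀ p q, (σ * π').SameCycle p q) :
    cost x y π ≤ cost x y π' := by
  obtain ⟨C, hC, -⟩ := h.opt π' hπ'
  omega

end SortedTour

/-! ### Ranks -/

/-- The rank of `k` among the numbers below `N` with respect to the key `a`, where ties are broken
by index. -/
def keyRank (a : ℕ → ℕ) (N k : ℕ) : ℕ :=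
  ((Finset.range N).filter fun l => a l < a k ∨ a l = a k ∧ l < k).card

namespace keyRank

variable {a : ℕ → ℕ} {N : ℕ}

theorem lt_of_key_lt {k k' : ℕ} (hk : k < N) (h : a k < a k' ∨ a k = a k' ∧ k < k') :
    keyRank a N k < keyRank a N k' := by
  refine Finset.card_lt_card ⟨fun l hl => ?_, fun hs => ?_⟩
  · simp only [Finset.mem_filter] at hl ⊢
    exact ⟨hl.1, by omega⟩
  · have := hs (Finset.mem_filter.2 ⟨Finset.mem_range.2 hk, h⟩)
    simp at this

theorem lt_card {k : ℕ} (hk : k < N) : keyRank a N k < N := by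
  have : keyRank a N k < (Finset.range N).card := by
    refine Finset.card_lt_card ⟨Finset.filter_subset _ _, fun hs => ?_⟩
    have := hs (Finset.mem_range.2 hk)
    simp at this
  rwa [Finset.card_range] at this

theorem injOn {k k' : ℕ} (hk : k < N) (hk' : k' < N) (h : keyRank a N k = keyRank a N k') :
    k = k' := by
  by_contra hne
  by_cases h₁ : a k < a k' ∨ a k = a k' ∧ k < k'
  · exact (lt_of_key_lt hk h₁).ne h
  · exact (lt_of_key_lt hk' (by omega)).ne h.symm

theorem key_le {k k' : ℕ} (hk' : k' < N) (h : keyRank a N k ≤ keyRank a N k') : a k ≤ a k' := by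
  by_contra hlt
  exact absurd (lt_of_key_lt hk' (.inl (not_le.1 hlt))) (not_lt.2 h)

/-- The ranks as a permutation. -/
noncomputable def perm (a : ℕ → ℕ) (n : ℕ) : Equiv.Perm (Fin (n + 1)) :=
  Equiv.ofBijective (fun k => ⟨keyRank a (n + 1) k, lt_card k.2⟩)
    (Finite.injective_iff_bijective.1 fun k k' h =>
      Fin.ext (injOn k.2 k'.2 (congrArg Fin.val h)))

@[simp] theorem perm_val (a : ℕ → ℕ) (n : ℕ) (k : Fin (n + 1)) :
    (perm a n k : ℕ) = keyRank a (n + 1) k := rfl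

theorem monotone_perm_symm (a : ℕ → ℕ) (n : ℕ) :
    Monotone fun p : Fin (n + 1) => a ((perm a n).symm p) := by
  intro p q hpq
  refine key_le (N := n + 1) ((perm a n).symm q).2 ?_
  rw [← perm_val, ← perm_val, Equiv.apply_symm_apply, Equiv.apply_symm_apply]
  exact hpq

theorem eq_zero {k : ℕ} (hk : ∀ l < N, l ≠ k → a k < a l) : keyRank a N k = 0 := by
  refine Finset.card_eq_zero.2 (Finset.filter_eq_empty_iff.2 fun l hl h => ?_)
  rcases eq_or_ne l k with rfl | hne
  · omega
  · have := hk l (Finset.mem_range.1 hl) hne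
    omega

end keyRank

/-! ### Paths and tours -/

namespace EnergyInstance

open Equiv Equiv.Perm

variable (I : EnergyInstance)

/-- The acceleration times, continued by `0`. -/
def extAc (i : ℕ) : ℕ := if h : i < I.n then I.tAc ⟨i, h⟩ else 0

/-- The braking times, continued by `0`. -/
def extBr (i : ℕ) : ℕ := if h : i < I.n then I.tBr ⟨i, h⟩ else 0

/-- The weight of a permutation of the lines and one additional line with all times `0`. -/
def permWeight (τ : Perm (Fin (I.n + 1))) : ℕ :=
  ∑ k : Fin (I.n + 1), min (I.extAc k) (I.extBr (τ k))

/-- The path that serves the lines in the given order. -/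
def linePath {n : ℕ} (L : List (Fin n)) : List (StationEvent n) :=
  L.flatMap fun ℓ => [StationEvent.arr ℓ, StationEvent.dep ℓ]

theorem adj_arr {n : ℕ} {ℓ : Fin n} {v : StationEvent n}
    (h : (energyNetwork n).Adj (StationEvent.arr ℓ) v) : v = StationEvent.dep ℓ := by
  rcases h with ⟨m, hm⟩ | ⟨k, m, hm⟩
  · simp only [Prod.mk.injEq, StationEvent.arr.injEq] at hm
    rw [hm.1, hm.2]
  · simp at hm

theorem adj_dep {n : ℕ} {ℓ : Fin n} {v : StationEvent n}
    (h : (energyNetwork n).Adj (StationEvent.dep ℓ) v) : ∃ m, v = StationEvent.arr m := by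
  rcases h with ⟨m, hm⟩ | ⟨k, m, hm⟩
  · simp at hm
  · simp only [Prod.mk.injEq] at hm
    exact ⟨m, hm.2⟩

theorem pathArcs_cons_cons {V : Type*} (u v : V) (P : List V) :
    pathArcs (u :: v :: P) = (u, v) :: pathArcs (v :: P) := rfl

theorem mem_tail_of_mem_pathArcs {V : Type*} {P : List V} {u v : V} (h : (u, v) ∈ pathArcs P) :
    v ∈ P.tail := (List.of_mem_zip h).2

/-- Only its own departure can follow an arrival, and only arrivals follow a departure. The last
hypothesis prevents the path from ending in an arrival. -/
theorem exists_eq_linePath {n : ℕ} :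
    ∀ {P : List (StationEvent n)}, P.IsChain (energyNetwork n).Adj → P.Nodup →
      (∀ ℓ, P.head? ≠ some (StationEvent.dep ℓ)) →
      (∀ ℓ, StationEvent.arr ℓ ∈ P → (StationEvent.arr ℓ, StationEvent.dep ℓ) ∈ pathArcs P) →
      ∃ L, P = linePath L
  | [], _, _, _, _ => ⟨[], rfl⟩
  | [StationEvent.arr ℓ], _, _, _, h => by simpa [pathArcs] using h ℓ (by simp)
  | StationEvent.dep ℓ :: _, _, _, h, _ => absurd rfl (h ℓ)
  | StationEvent.arr ℓ :: v :: P, hc, hn, _, h => by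
    rw [List.isChain_cons_cons] at hc
    obtain rfl := adj_arr hc.1
    have hhead : ∀ m, P.head? ≠ some (StationEvent.dep m) := by
      intro m hm
      obtain ⟨P', rfl⟩ : ∃ P', P = StationEvent.dep m :: P' := by
        cases P with
        | nil => simp at hm
        | cons w P' =>
          simp only [List.head?_cons, Option.some.injEq] at hm
          exact ⟨P', by rw [hm]⟩
      obtain ⟨_, hk⟩ := adj_dep (List.isChain_cons_cons.1 hc.2).1
      cases hk
    have harcs : ∀ m, StationEvent.arr m ∈ P →
        (StationEvent.arr m, StationEvent.dep m) ∈ pathArcs P := by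
      intro m hm
      have := h m (List.mem_cons_of_mem _ (List.mem_cons_of_mem _ hm))
      rw [pathArcs_cons_cons, List.mem_cons] at this
      rcases this with e | this
      · simp only [Prod.mk.injEq, StationEvent.arr.injEq] at e
        rw [e.1] at hm
        simp [hm] at hn
      · cases P with
        | nil => simp at hm
        | cons w P' =>
          rw [pathArcs_cons_cons, List.mem_cons] at this
          rcases this with e | this
          · simp at e
          · exact this
    have hn' := (List.nodup_cons.1 (List.nodup_cons.1 hn).2).2
    obtain ⟨L, rfl⟩ := exists_eq_linePath (hc.2.tail) hn' hhead harcs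
    exact ⟨ℓ :: L, rfl⟩

theorem IsAdmissiblePath.exists_linePath {I : EnergyInstance} {P : List (StationEvent I.n)}
    (h : I.IsAdmissiblePath P) : ∃ L, P = linePath L := by
  refine exists_eq_linePath h.1.isChain h.1.nodup (fun ℓ hℓ => ?_) fun ℓ _ => h.2 _ ⟨ℓ, rfl⟩
  -- If the path began with `dep ℓ`, the waiting arc of `ℓ` would make this vertex occur again in
  -- the tail.
  have := mem_tail_of_mem_pathArcs (h.2 _ ⟨ℓ, rfl⟩)
  have hn := h.1.nodup
  cases P with
  | nil => simp at hℓ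
  | cons w P =>
    simp only [List.head?_cons, Option.some.injEq] at hℓ
    subst hℓ
    exact (List.nodup_cons.1 hn).1 this

theorem mem_linePath {n : ℕ} {L : List (Fin n)} {v : StationEvent n} :
    v ∈ linePath L ↔ ∃ ℓ ∈ L, v = StationEvent.arr ℓ ∨ v = StationEvent.dep ℓ := by
  simp [linePath]

theorem nodup_linePath {n : ℕ} {L : List (Fin n)} : (linePath L).Nodup ↔ L.Nodup := by
  induction L with
  | nil => simp [linePath]
  | cons ℓ L ih =>
    have : linePath (ℓ :: L) = StationEvent.arr ℓ :: StationEvent.dep ℓ :: linePath L := rfl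
    rw [this, List.nodup_cons, List.nodup_cons, List.nodup_cons, ih]
    simp [mem_linePath]

theorem mem_of_forall_mem_linePath {n : ℕ} {L : List (Fin n)} (h : ∀ v, v ∈ linePath L)
    (ℓ : Fin n) : ℓ ∈ L := by
  simpa [mem_linePath] using h (StationEvent.arr ℓ)

theorem isAdmissiblePath_linePath {L : List (Fin I.n)} (hn : L.Nodup) (hL : ∀ ℓ, ℓ ∈ L) :
    I.IsAdmissiblePath (linePath L) := by
  refine ⟨⟨?_, nodup_linePath.2 hn, fun v => ?_⟩, ?_⟩
  · clear hn hL
    induction L with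
    | nil => exact .nil
    | cons ℓ L ih =>
      have e : linePath (ℓ :: L) = StationEvent.arr ℓ :: StationEvent.dep ℓ :: linePath L := rfl
      rw [e]
      refine List.isChain_cons_cons.2 ⟨.inl ⟨ℓ, rfl⟩, ?_⟩
      cases L with
      | nil => exact .singleton _
      | cons m L => exact List.isChain_cons_cons.2 ⟨.inr ⟨ℓ, m, rfl⟩, ih⟩
  · rw [mem_linePath]
    cases v with
    | arr ℓ => exact ⟨ℓ, hL ℓ, .inl rfl⟩
    | dep ℓ => exact ⟨ℓ, hL ℓ, .inr rfl⟩
  · rintro _ ⟨ℓ, rfl⟩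
    have := hL ℓ
    clear hn hL
    induction L with
    | nil => simp at this
    | cons m L ih =>
      have e : linePath (m :: L) = StationEvent.arr m :: StationEvent.dep m :: linePath L := rfl
      rw [e, pathArcs_cons_cons, List.mem_cons]
      rcases List.mem_cons.1 this with rfl | h
      · exact .inl rfl
      · refine .inr ?_
        have harc := ih h
        cases L with
        | nil => simp at h
        | cons k L =>
          exact List.mem_cons_of_mem _ harc

/-- The lines in the given order, preceded by the additional line. -/
def tourList {n : ℕ} (L : List (Fin n)) : List (Fin (n + 1)) :=
  Fin.last n :: L.map Fin.castSucc

theorem nodup_tourList {n : ℕ} {L : List (Fin n)} (h : L.Nodup) : (tourList L).Nodup := by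
  refine List.nodup_cons.2 ⟨fun hm => ?_, h.map (Fin.castSucc_injective n)⟩
  obtain ⟨ℓ, -, hℓ⟩ := List.mem_map.1 hm
  exact Fin.castSucc_ne_last ℓ hℓ

theorem mem_tourList {n : ℕ} {L : List (Fin n)} (h : ∀ ℓ, ℓ ∈ L) (k : Fin (n + 1)) :
    k ∈ tourList L := by
  refine Fin.lastCases (List.mem_cons_self ..) (fun ℓ => ?_) k
  exact List.mem_cons_of_mem _ (List.mem_map_of_mem (h ℓ))

theorem extAc_castSucc (ℓ : Fin I.n) : I.extAc (ℓ.castSucc : Fin (I.n + 1)) = I.tAc ℓ := by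
  simp [extAc]

theorem extBr_castSucc (ℓ : Fin I.n) : I.extBr (ℓ.castSucc : Fin (I.n + 1)) = I.tBr ℓ := by
  simp [extBr]

theorem extAc_last : I.extAc (Fin.last I.n) = 0 := by simp [extAc]

theorem pathWeight_linePath {τ : Perm (Fin (I.n + 1))} {ℓ : Fin I.n} {L : List (Fin I.n)}
    (hc : (List.map Fin.castSucc (ℓ :: L)).IsChain fun k l => τ k = l)
    (hl : ∀ k ∈ (List.map Fin.castSucc (ℓ :: L)).getLast?, τ k = Fin.last I.n) :
    I.pathWeight (linePath (ℓ :: L)) =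
      (((ℓ :: L).map Fin.castSucc).map fun k : Fin (I.n + 1) =>
        min (I.extAc k) (I.extBr (τ k))).sum := by
  induction L generalizing ℓ with
  | nil =>
    have := hl ℓ.castSucc (by simp)
    simp [pathWeight, linePath, pathArcs, arcWeight, this, extBr]
  | cons m L ih =>
    rw [List.map_cons, List.map_cons, List.isChain_cons_cons] at hc
    have := ih hc.2 (by simpa using hl)
    rw [List.map_cons, List.map_cons, List.sum_cons, ← this, hc.1, extAc_castSucc, extBr_castSucc]
    simp [pathWeight, linePath, pathArcs, arcWeight]

/-- Both arcs at the additional line have weight `0`, so closing the path to a tour changes nothing.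
-/
theorem pathWeight_eq_permWeight {L : List (Fin I.n)} (hn : L.Nodup) (hL : ∀ ℓ, ℓ ∈ L)
    {τ : Perm (Fin (I.n + 1))} (hc : (tourList L).IsChain fun k l => τ k = l)
    (hl : ∀ k ∈ (tourList L).getLast?, τ k = Fin.last I.n) :
    I.pathWeight (linePath L) = I.permWeight τ := by
  have e : I.permWeight τ =
      ((tourList L).map fun k : Fin (I.n + 1) => min (I.extAc k) (I.extBr (τ k))).sum := by
    rw [permWeight, ← List.sum_toFinset _ (nodup_tourList hn)]
    refine Finset.sum_congr (Finset.ext fun k => ?_) fun _ _ => rfl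
    simp [mem_tourList hL k]
  rw [e, tourList, List.map_cons, List.sum_cons, extAc_last, Nat.zero_min, zero_add]
  cases L with
  | nil => rfl
  | cons ℓ L =>
    rw [tourList, List.map_cons, List.isChain_cons_cons] at hc
    exact I.pathWeight_linePath hc.2 (by simpa [tourList] using hl)

/-- Every admissible path is a cyclic permutation of the lines and the additional line. -/
theorem IsAdmissiblePath.exists_perm {I : EnergyInstance} {P : List (StationEvent I.n)}
    (h : I.IsAdmissiblePath P) :
    ∃ τ : Perm (Fin (I.n + 1)), (∀ k l, τ.SameCycle k l) ∧ I.pathWeight P = I.permWeight τ := by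
  obtain ⟨L, rfl⟩ := h.exists_linePath
  have hn := nodup_linePath.1 h.1.nodup
  have hL := mem_of_forall_mem_linePath h.1.mem_all
  have hn' := nodup_tourList hn
  refine ⟨(tourList L).formPerm, fun k l => ?_, ?_⟩
  · exact hn'.isCycleOn_formPerm.2 (mem_tourList hL k) (mem_tourList hL l)
  · refine I.pathWeight_eq_permWeight hn hL ?_ ?_
    · refine List.isChain_iff_getElem.2 fun i hi => ?_
      exact List.formPerm_apply_lt_getElem _ hn' i hi
    · intro k hk
      rw [tourList, List.getLast?_eq_some_getLast (List.cons_ne_nil _ _), Option.mem_def,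
        Option.some.injEq] at hk
      rw [← hk, tourList, List.formPerm_apply_getLast]

theorem isCycleOn_univ {n : ℕ} {τ : Perm (Fin (n + 1))} (h : ∀ k l, τ.SameCycle k l) :
    τ.IsCycleOn ((Finset.univ : Finset (Fin (n + 1))) : Set (Fin (n + 1))) := by
  rw [Finset.coe_univ]
  exact ⟨Set.bijOn_univ.2 τ.bijective, fun k _ l _ => h k l⟩

/-- The order in which a cyclic permutation visits the lines after the additional line. -/
theorem exists_visitOrder {n : ℕ} {τ : Perm (Fin (n + 1))} (h : ∀ k l, τ.SameCycle k l) :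
    ∃ L : List (Fin n), L.Nodup ∧ (∀ ℓ, ℓ ∈ L) ∧
      tourList L = (List.range (n + 1)).map fun i => (τ ^ i) (Fin.last n) := by
  have hc := isCycleOn_univ h
  have hmem := Finset.mem_univ (Fin.last n)
  have hinj : ∀ i < n + 1, ∀ j < n + 1, (τ ^ i) (Fin.last n) = (τ ^ j) (Fin.last n) → i = j := by
    intro i hi j hj e
    rw [hc.pow_apply_eq_pow_apply hmem, Finset.card_univ, Fintype.card_fin] at e
    exact Nat.ModEq.eq_of_lt_of_lt e hi hj
  have hne : ∀ i : Fin n, (τ ^ (i + 1 : ℕ)) (Fin.last n) ≠ Fin.last n := by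
    intro i e
    have := hinj (i + 1) (by omega) 0 (by omega) (by simpa using e)
    omega
  refine ⟨List.ofFn fun i : Fin n => ((τ ^ (i + 1 : ℕ)) (Fin.last n)).castPred (hne i), ?_, ?_, ?_⟩
  · refine List.nodup_ofFn.2 fun i j e => Fin.ext ?_
    have := hinj (i + 1) (by omega) (j + 1) (by omega) (Fin.castPred_inj.1 e)
    omega
  · intro ℓ
    obtain ⟨i, hi, e⟩ := hc.exists_pow_eq hmem (Finset.mem_univ ℓ.castSucc)
    rw [Finset.card_univ, Fintype.card_fin] at hi
    rcases i with _ | i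
    · exact absurd e.symm (Fin.castSucc_ne_last ℓ)
    · refine List.mem_ofFn.2 ⟨⟨i, by omega⟩, ?_⟩
      apply Fin.castSucc_injective
      rw [Fin.castSucc_castPred]
      exact e
  · rw [tourList, List.range_succ_eq_map, List.map_cons, List.map_map]
    congr 1
    rw [List.map_ofFn]
    refine List.ext_getElem (by simp) fun i h₁ h₂ => ?_
    simp

/-- A cyclic permutation visits the lines in an order that gives an admissible path of the same
weight. -/
theorem exists_admissiblePath {τ : Perm (Fin (I.n + 1))} (h : ∀ k l, τ.SameCycle k l) :
    ∃ L : List (Fin I.n), I.IsAdmissiblePath (linePath L) ∧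
      I.pathWeight (linePath L) = I.permWeight τ ∧ L.length = I.n ∧
      ∀ (i : ℕ) (hi : i < L.length), (L[i]).castSucc = (τ ^ (i + 1)) (Fin.last I.n) := by
  obtain ⟨L, hn, hL, e⟩ := exists_visitOrder h
  have hlen : L.length = I.n := by
    have := congrArg List.length e
    simpa [tourList] using this
  refine ⟨L, I.isAdmissiblePath_linePath hn hL, I.pathWeight_eq_permWeight hn hL ?_ ?_, hlen, ?_⟩
  · rw [e]
    refine List.isChain_iff_getElem.2 fun i hi => ?_
    simp [pow_succ']
  · rw [e, List.range_succ, List.map_append]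
    intro k hk
    simp only [List.map_cons, List.map_nil, List.getLast?_concat, Option.mem_def,
      Option.some.injEq] at hk
    rw [← hk, ← mul_apply, ← pow_succ']
    have := (isCycleOn_univ h).pow_card_apply (Finset.mem_univ (Fin.last I.n))
    rwa [Finset.card_univ, Fintype.card_fin] at this
  · intro i hi
    have h₁ : i + 1 < (tourList L).length := by simp [tourList, hi]
    have : (tourList L)[i + 1] = (τ ^ (i + 1)) (Fin.last I.n) := by
      simp [e]
    simpa [tourList] using this

theorem getElem_linePath {n : ℕ} {L : List (Fin n)} {i : ℕ} (hi : i < L.length)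
    (h₁ : 2 * i < (linePath L).length) (h₂ : 2 * i + 1 < (linePath L).length) :
    (linePath L)[2 * i] = StationEvent.arr L[i] ∧
      (linePath L)[2 * i + 1] = StationEvent.dep L[i] := by
  induction L generalizing i with
  | nil => simp at hi
  | cons ℓ L ih =>
    rcases i with _ | i
    · exact ⟨rfl, rfl⟩
    · have e : linePath (ℓ :: L) = StationEvent.arr ℓ :: StationEvent.dep ℓ :: linePath L := rfl
      simp only [List.length_cons] at hi
      simp only [e, List.length_cons] at h₁ h₂
      obtain ⟨a, b⟩ := ih (i := i) (by omega) (by omega) (by omega)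
      exact ⟨a, b⟩

theorem length_linePath {n : ℕ} (L : List (Fin n)) : (linePath L).length = 2 * L.length := by
  rw [linePath, List.length_flatMap]
  simp [mul_comm]

/-! ### The reduction to sorted data -/

/-- The acceleration times in increasing order. -/
noncomputable def sortedAc (p : Fin (I.n + 1)) : ℕ := I.extAc ((keyRank.perm I.extAc I.n).symm p)

/-- The braking times in increasing order. -/
noncomputable def sortedBr (p : Fin (I.n + 1)) : ℕ := I.extBr ((keyRank.perm I.extBr I.n).symm p)

/-- The departure position of the line with the given arrival position. -/
noncomputable def posPerm : Perm (Fin (I.n + 1)) :=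
  keyRank.perm I.extAc I.n * (keyRank.perm I.extBr I.n)⁻¹

/-- The permutation of lines that belongs to an assignment of positions. -/
noncomputable def linePerm (π : Perm (Fin (I.n + 1))) : Perm (Fin (I.n + 1)) :=
  (keyRank.perm I.extAc I.n)⁻¹ * (I.posPerm * π) * keyRank.perm I.extAc I.n

theorem linePerm_apply (π : Perm (Fin (I.n + 1))) (k : Fin (I.n + 1)) :
    I.linePerm π k = (keyRank.perm I.extBr I.n)⁻¹ (π (keyRank.perm I.extAc I.n k)) := by
  simp [linePerm, posPerm]

theorem linePerm_surjective (τ : Perm (Fin (I.n + 1))) : ∃ π, I.linePerm π = τ := by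
  refine ⟨keyRank.perm I.extBr I.n * τ * (keyRank.perm I.extAc I.n)⁻¹, Equiv.ext fun k => ?_⟩
  simp [linePerm_apply]

theorem sameCycle_linePerm {π : Perm (Fin (I.n + 1))} :
    (∀ k l, (I.linePerm π).SameCycle k l) ↔ ∀ p q, (I.posPerm * π).SameCycle p q := by
  have e : I.linePerm π = (keyRank.perm I.extAc I.n)⁻¹ * (I.posPerm * π) *
    (keyRank.perm I.extAc I.n)⁻¹⁻¹ := by rw [inv_inv, linePerm]
  rw [e]
  simp_rw [sameCycle_conj]
  rw [inv_inv]
  exact ⟨fun h p q => by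
    simpa using h ((keyRank.perm I.extAc I.n)⁻¹ p) ((keyRank.perm I.extAc I.n)⁻¹ q),
    fun h k l => h _ _⟩

/-- The right side does not depend on `π`, so maximum weight is the same as minimum cost. -/
theorem permWeight_add_cost (π : Perm (Fin (I.n + 1))) :
    I.permWeight (I.linePerm π) + SortedTour.cost I.sortedAc I.sortedBr π =
      ∑ p, I.sortedAc p := by
  have e : I.permWeight (I.linePerm π) = ∑ p, min (I.sortedAc p) (I.sortedBr (π p)) := by
    rw [permWeight, ← Equiv.sum_comp (keyRank.perm I.extAc I.n) fun p =>
      min (I.sortedAc p) (I.sortedBr (π p))]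
    refine Finset.sum_congr rfl fun k _ => ?_
    rw [sortedAc, sortedBr, linePerm_apply, Equiv.symm_apply_apply]
    rfl
  rw [e, SortedTour.cost, ← Finset.sum_add_distrib]
  exact Finset.sum_congr rfl fun p _ => by omega

theorem monotone_sortedAc : Monotone I.sortedAc := keyRank.monotone_perm_symm _ _

theorem monotone_sortedBr : Monotone I.sortedBr := keyRank.monotone_perm_symm _ _

/-- As acceleration times are positive, the additional line has the strictly smallest key. This
tells the program where to start the output. -/
theorem perm_extAc_last : keyRank.perm I.extAc I.n (Fin.last I.n) = 0 := by
  refine Fin.ext (keyRank.eq_zero fun l hl hne => ?_)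
  rw [extAc_last]
  rw [Fin.val_last] at hne
  rw [extAc, dif_pos (by omega)]
  exact I.tAc_pos _

/-- A tour that is obtained by merging gives an optimal path. -/
theorem exists_isMaxWeightPath {π : Perm (Fin (I.n + 1))}
    (hπ : SortedTour.MergeInv I.sortedAc I.sortedBr I.posPerm π)
    (h : ∀ p q, (I.posPerm * π).SameCycle p q) :
    ∃ L : List (Fin I.n), I.IsMaxWeightPath (linePath L) ∧ L.length = I.n ∧
      ∀ (i : ℕ) (hi : i < L.length),
        (L[i]).castSucc = (keyRank.perm I.extAc I.n).symm (((I.posPerm * π) ^ (i + 1)) 0) := by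
  obtain ⟨L, hadm, hw, hlen, hL⟩ := I.exists_admissiblePath (I.sameCycle_linePerm.2 h)
  refine ⟨L, ⟨hadm, fun Q hQ => ?_⟩, hlen, fun i hi => ?_⟩
  · obtain ⟨τ, hτ, hQw⟩ := hQ.exists_perm
    obtain ⟨π', rfl⟩ := I.linePerm_surjective τ
    have h₁ := hπ.cost_le (I.sameCycle_linePerm.1 hτ)
    have h₂ := I.permWeight_add_cost π
    have h₃ := I.permWeight_add_cost π'
    omega
  · rw [hL i hi, ← perm_extAc_last]
    have e : I.linePerm π ^ (i + 1) = (keyRank.perm I.extAc I.n)⁻¹ *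
        (I.posPerm * π) ^ (i + 1) * keyRank.perm I.extAc I.n := by
      have := conj_pow (i := i + 1) (a := (keyRank.perm I.extAc I.n)⁻¹) (b := I.posPerm * π)
      rwa [inv_inv] at this
    rw [e]
    rfl

end EnergyInstance

/-! ### The program -/

namespace RamProgram

/-- Run the programs of a list one after another. -/
def block : List RamProgram → RamProgram
  | [] => skip
  | p :: ps => seq p (block ps)

/-- Add `1` to register `q` if the line in register `4` precedes the line in register `3`, whose
key is in register `r`, with respect to the keys in array `a`. -/
def rankStep (a r q : ℕ) : List RamProgram :=
  [load 14 a 4, sub 15 3 4, sub 15 1 15, sub 15 1 15, add 16 r 15, sub 16 16 14, sub 16 1 16,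
    sub 16 1 16, add q q 16]

/-- The body of `rankLoop`. -/
def rankBody : RamProgram := block (rankStep 0 10 12 ++ rankStep 1 11 13)

/-- Compute the ranks of the line in register `3`. -/
def rankLoop : RamProgram := forDown 4 rankBody

/-- Load the times of the line in register `3`. -/
def loadLine : RamProgram :=
  block [load 10 0 3, load 11 1 3, const 12 0, const 13 0, add 4 2 9]

/-- Enter the line in register `3` into the sorted arrays. -/
def placeLine : RamProgram :=
  block [store 3 12 10, store 4 13 11, store 5 13 12, store 6 12 3, store 7 3 3, store 8 3 3]

/-- Set up the constants in the registers. -/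
def initRegs : RamProgram := block [const 1 1, add 2 0 1, add 3 2 9]

/-- Sort the times: arrays `3` and `4` receive the sorted times, array `5` the passage from arrival
positions to departure positions, array `6` the lines by departure position, and arrays `7` and
`8` the identity. -/
def sortPhase : RamProgram :=
  seq initRegs (forDown 3 (seq loadLine (seq rankLoop placeLine)))

/-- The body of `orbitLoop`. -/
def orbitBody : RamProgram :=
  block [load 6 7 6, load 6 5 6, sub 14 5 6, sub 15 6 5, add 14 14 15, sub 14 1 14, add 13 13 14]

/-- Walk along the cycle of the position in register `6` and count in register `13` the visits to
the position in register `5`. -/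
def orbitLoop : RamProgram := forDown 7 orbitBody

/-- Prepare `orbitLoop` for the edge in register `4`. -/
def initOrbit : RamProgram := block [add 5 4 1, add 6 4 9, const 13 0, add 7 2 9]

/-- Record the edge in register `4` as the best one. -/
def recordEdge : RamProgram := block [const 10 1, add 11 4 9, add 12 16 9]

/-- Compare the gap at the edge in register `4` with the best one. -/
def compareEdge : RamProgram :=
  block [load 20 3 4, load 21 4 4, load 22 3 5, load 23 4 5, sub 24 21 20, add 24 20 24,
    sub 25 22 23, sub 25 22 25, sub 16 25 24, sub 17 12 16, cond 10 (cond 17 recordEdge skip)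
    recordEdge]

/-- Process the edge in register `4`. -/
def testEdge : RamProgram := seq initOrbit (seq orbitLoop (cond 13 skip compareEdge))

/-- Prepare the search for an edge. -/
def initSearch : RamProgram := block [const 10 0, add 4 0 9]

/-- Find an edge with least gap between different cycles. -/
def searchEdge : RamProgram := seq initSearch (forDown 4 testEdge)

/-- Determine the jumps that take part in the exchange at the edge in register `11`. -/
def selectJumps : RamProgram :=
  block [add 5 11 1, load 20 3 11, load 21 4 11, load 22 3 5, load 23 4 5, sub 24 20 21,
    sub 25 22 23, cond 24 (add 26 11 9) (load 26 8 11), cond 25 (load 27 8 5) (add 27 5 9)]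

/-- Exchange the destinations of the jumps in registers `26` and `27`. -/
def swapJumps : RamProgram :=
  block [load 28 7 26, load 29 7 27, store 7 26 29, store 7 27 28, store 8 29 26, store 8 28 27]

/-- Perform the exchange at the edge in register `11`. -/
def exchangeEdge : RamProgram := seq selectJumps swapJumps

/-- One round of merging. -/
def mergeRound : RamProgram := seq searchEdge (cond 10 exchangeEdge skip)

/-- Merge all cycles. -/
def mergePhase : RamProgram := seq (add 3 2 9) (forDown 3 mergeRound)

/-- Prepare the output. -/
def initOutput : RamProgram := block [add 3 0 9, const 6 0, const 4 0]

/-- Move on by one line and write its two events. -/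
def outputBody : RamProgram :=
  block [load 6 7 6, load 6 5 6, load 10 6 6, add 11 10 10, store 2 4 11, add 4 4 1, add 11 11 1,
    store 2 4 11, add 4 4 1]

/-- Write the path into array `2`. -/
def outputPhase : RamProgram := seq initOutput (forDown 3 outputBody)

/-- The program that computes a path of maximum weight. -/
def pathProgram : RamProgram := seq sortPhase (seq mergePhase outputPhase)

/-! ### Correctness of the phases -/

theorem wp_rankLoop {s₀ : RamState} {N k : ℕ} (h1 : s₀.reg 1 = 1) (h3 : s₀.reg 3 = k)
    (h4 : s₀.reg 4 = N) (h10 : s₀.reg 10 = s₀.arr 0 k) (h11 : s₀.reg 11 = s₀.arr 1 k)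
    (h12 : s₀.reg 12 = 0) (h13 : s₀.reg 13 = 0) :
    rankLoop.Wp (N * (rankBody.steps + 2) + 1) (fun s =>
      s.reg 12 = keyRank (s₀.arr 0) N k ∧ s.reg 13 = keyRank (s₀.arr 1) N k) s₀ := by
  -- `1 - (1 - z)` is the indicator of `z ≠ 0`; adding the indicator of `l < k` to `u` breaks ties
  -- by index.
  have hterm : ∀ u v l : ℕ, 1 - (1 - (u + (1 - (1 - (k - l))) - v)) =
      if v < u ∨ v = u ∧ l < k then 1 else 0 := by
    intro u v l
    split_ifs <;> omega
  refine (wp_forDown (m := N) (fun l s =>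
    (s.reg 12 = ∑ i ∈ Finset.Ico l N, if s₀.arr 0 i < s₀.arr 0 k ∨ s₀.arr 0 i = s₀.arr 0 k ∧ i < k
      then 1 else 0) ∧
    (s.reg 13 = ∑ i ∈ Finset.Ico l N, if s₀.arr 1 i < s₀.arr 1 k ∨ s₀.arr 1 i = s₀.arr 1 k ∧ i < k
      then 1 else 0)) (by decide) (by decide) h4 h1 (fun _ _ h => h) (by simp [h12, h13])
    (fun l hl s hf hs h => wp_eval (by decide) ?_)).mono le_rfl ?_
  · have r1 : s.reg 1 = 1 := (hf.1 1 (by decide)).trans h1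
    have r3 : s.reg 3 = k := (hf.1 3 (by decide)).trans h3
    have r10 := (hf.1 10 (by decide)).trans h10
    have r11 := (hf.1 11 (by decide)).trans h11
    have a0 := hf.2 0 (by decide)
    have a1 := hf.2 1 (by decide)
    rw [Finset.sum_eq_sum_Ico_succ_bot hl, Finset.sum_eq_sum_Ico_succ_bot hl, ← h.1, ← h.2,
      ← hterm, ← hterm]
    simp [rankBody, block, rankStep, eval, r1, r3, hs, r10, r11, a0, a1, Nat.add_comm]
  · intro s _ h
    simp only [Finset.sum_boole, Nat.cast_id] at h
    rwa [keyRank, keyRank, Finset.range_eq_Ico]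

/-- The effect of `sortPhase` for the lines from `k` on. -/
structure Sorted (a b : ℕ → ℕ) (N k : ℕ) (s : RamState) : Prop where
  ac : ∀ i, k ≤ i → i < N → s.arr 3 (keyRank a N i) = a i
  br : ∀ i, k ≤ i → i < N → s.arr 4 (keyRank b N i) = b i
  pos : ∀ i, k ≤ i → i < N → s.arr 5 (keyRank b N i) = keyRank a N i
  line : ∀ i, k ≤ i → i < N → s.arr 6 (keyRank a N i) = i
  perm : ∀ i, k ≤ i → i < N → s.arr 7 i = i
  inv : ∀ i, k ≤ i → i < N → s.arr 8 i = i

/-- A bound for the number of steps of `sortPhase`. -/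
def sortSteps (N : ℕ) : ℕ :=
  initRegs.steps +
    (N * (loadLine.steps + (N * (rankBody.steps + 2) + 1 + placeLine.steps) + 2) + 1)

theorem wp_sortPhase {s₀ : RamState} {n : ℕ} (h0 : s₀.reg 0 = n) (h9 : s₀.reg 9 = 0) :
    sortPhase.Wp (sortSteps (n + 1)) (fun s => s.reg 1 = 1 ∧ s.reg 2 = n + 1 ∧
      Sorted (s₀.arr 0) (s₀.arr 1) (n + 1) 0 s) s₀ := by
  refine Wp.seq (wp_eval (by decide) ?_)
  generalize hs₁ : initRegs.eval s₀ = s₁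
  have r1 : s₁.reg 1 = 1 := by simp [← hs₁, initRegs, block, eval]
  have r2 : s₁.reg 2 = n + 1 := by simp [← hs₁, initRegs, block, eval, h0]
  have r3 : s₁.reg 3 = n + 1 := by simp [← hs₁, initRegs, block, eval, h0, h9]
  have r9 : s₁.reg 9 = 0 := by simp [← hs₁, initRegs, block, eval, h9]
  have ar : s₁.arr = s₀.arr := by simp [← hs₁, initRegs, block, eval]
  refine (wp_forDown (m := n + 1) (fun k s => Sorted (s₀.arr 0) (s₀.arr 1) (n + 1) k s)
    (by decide) (by decide) r3 r1 (fun _ _ h => ⟨h.ac, h.br, h.pos, h.line, h.perm, h.inv⟩)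
    ⟨by omega, by omega, by omega, by omega, by omega, by omega⟩
    (fun k hk s hf hs h => Wp.seq (wp_eval (by decide) (Wp.seq ?_)))).mono le_rfl ?_
  · have q1 : s.reg 1 = 1 := (hf.1 1 (by decide)).trans r1
    have q2 : s.reg 2 = n + 1 := (hf.1 2 (by decide)).trans r2
    have q9 : s.reg 9 = 0 := (hf.1 9 (by decide)).trans r9
    have a0 : s.arr 0 = s₀.arr 0 := (hf.2 0 (by decide)).trans (by rw [ar])
    have a1 : s.arr 1 = s₀.arr 1 := (hf.2 1 (by decide)).trans (by rw [ar])
    refine (wp_rankLoop (N := n + 1) (k := k) ?_ ?_ ?_ ?_ ?_ ?_ ?_).mono le_rfl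
      fun t ht htr => wp_eval (by decide) ?_
    any_goals simp [loadLine, block, eval, hs, q1, q2, q9]
    have e : (loadLine.eval s).arr = s.arr := by simp [loadLine, block, eval]
    rw [e, a0, a1] at htr
    have t3 : t.reg 3 = k := by
      rw [ht.1 3 (by decide)]
      simp [loadLine, block, eval, hs]
    have t10 : t.reg 10 = s₀.arr 0 k := by
      rw [ht.1 10 (by decide)]
      simp [loadLine, block, eval, hs, a0]
    have t11 : t.reg 11 = s₀.arr 1 k := by
      rw [ht.1 11 (by decide)]
      simp [loadLine, block, eval, hs, a1]
    have ta : t.arr = s.arr := by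
      funext a
      rw [ht.2 a (by simp [rankLoop, forDown, rankBody, block, rankStep, writesArr]), e]
    -- Ranks are injective, so the entries for line `k` overwrite none of those already made for
    -- larger lines.
    have key : ∀ (c : ℕ → ℕ) (i : ℕ), k ≤ i → i < n + 1 → keyRank c (n + 1) i =
        keyRank c (n + 1) k → i = k := fun c i _ hi h => keyRank.injOn hi hk h
    constructor
    all_goals
      intro i hi hiN
      simp only [placeLine, block, eval, RamState.setArr_arr, RamState.setArr_reg, htr.1, htr.2,
        t3, t10, t11, ta]
      rcases eq_or_lt_of_le hi with rfl | hlt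
      · simp
    · rw [← h.ac i hlt hiN]
      have := key (s₀.arr 0) i hi hiN
      simp
      omega
    · rw [← h.br i hlt hiN]
      have := key (s₀.arr 1) i hi hiN
      simp
      omega
    · rw [← h.pos i hlt hiN]
      have := key (s₀.arr 1) i hi hiN
      simp
      omega
    · have := key (s₀.arr 0) i hi hiN
      simp [h.line i hlt hiN]
      omega
    · simp [h.perm i hlt hiN]
      omega
    · simp [h.inv i hlt hiN]
      omega
  · intro s hf h
    exact ⟨(hf.1 1 (by decide)).trans r1, (hf.1 2 (by decide)).trans r2, h⟩

end RamProgram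

/-! ### Correctness of merging and output -/

namespace RamProgram

open Equiv Equiv.Perm SortedTour

/-- The memory holds sorted data and an assignment of positions. -/
structure Holds {n : ℕ} (x y : Fin (n + 1) → ℕ) (σ π : Perm (Fin (n + 1))) (s : RamState) :
    Prop where
  reg0 : s.reg 0 = n
  reg1 : s.reg 1 = 1
  reg2 : s.reg 2 = n + 1
  reg9 : s.reg 9 = 0
  ac : ∀ p : Fin (n + 1), s.arr 3 p = x p
  br : ∀ p : Fin (n + 1), s.arr 4 p = y p
  pos : ∀ p : Fin (n + 1), s.arr 5 p = σ p
  perm : ∀ p : Fin (n + 1), s.arr 7 p = π p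
  inv : ∀ p : Fin (n + 1), s.arr 8 p = π⁻¹ p

variable {n : ℕ} {x y : Fin (n + 1) → ℕ} {σ π : Perm (Fin (n + 1))}

theorem Holds.of_frame {s s' : RamState} {p : RamProgram} (h : Holds x y σ π s) (hf : p.Frame s s')
    (hr : ∀ r ∈ [0, 1, 2, 9], r ∉ p.writes) (ha : ∀ a ∈ [3, 4, 5, 7, 8], a ∉ p.writesArr) :
    Holds x y σ π s' where
  reg0 := (hf.1 0 (hr 0 (by decide))).trans h.reg0
  reg1 := (hf.1 1 (hr 1 (by decide))).trans h.reg1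
  reg2 := (hf.1 2 (hr 2 (by decide))).trans h.reg2
  reg9 := (hf.1 9 (hr 9 (by decide))).trans h.reg9
  ac := by rw [hf.2 3 (ha 3 (by decide))]; exact h.ac
  br := by rw [hf.2 4 (ha 4 (by decide))]; exact h.br
  pos := by rw [hf.2 5 (ha 5 (by decide))]; exact h.pos
  perm := by rw [hf.2 7 (ha 7 (by decide))]; exact h.perm
  inv := by rw [hf.2 8 (ha 8 (by decide))]; exact h.inv

/-- A cycle has at most `n + 1` positions, so a walk of that length meets `j` iff `j` is on the
cycle of `i`. -/
theorem wp_orbitLoop {s₀ : RamState} (h : Holds x y σ π s₀) {i j : Fin (n + 1)} (hij : i ≠ j)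
    (h5 : s₀.reg 5 = j) (h6 : s₀.reg 6 = i) (h7 : s₀.reg 7 = n + 1) (h13 : s₀.reg 13 = 0) :
    orbitLoop.Wp ((n + 1) * (orbitBody.steps + 2) + 1) (fun s =>
      s.reg 13 = 0 ↔ ¬ (σ * π).SameCycle i j) s₀ := by
  refine (wp_forDown (m := n + 1) (fun k s => s.reg 6 = ((σ * π) ^ (n + 1 - k)) i ∧
    (s.reg 13 = 0 ↔ ∀ t, 1 ≤ t → t ≤ n + 1 - k → ((σ * π) ^ t) i ≠ j))
    (by decide) (by decide) h7 h.reg1 (fun _ _ h => h) ⟨by simpa using h6, ?_⟩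
    (fun k hk s hf hs hi => wp_eval (by decide) ?_)).mono le_rfl ?_
  · exact ⟨fun _ t _ _ => by omega, fun _ => h13⟩
  · have hh := h.of_frame hf (by decide) (by decide)
    have r5 := (hf.1 5 (by decide)).trans h5
    have e : n + 1 - k = (n + 1 - (k + 1)) + 1 := by omega
    have r6 : s.arr 5 (s.arr 7 (s.reg 6)) = ((σ * π) ^ (n + 1 - k)) i := by
      rw [hi.1, hh.perm, hh.pos, e, pow_succ', mul_apply, mul_apply]
    -- The two truncated differences add up to the distance, and `1` minus the distance is the
    -- indicator of equality.
    have hz : (s.reg 13 + (1 - (((j : ℕ) - (((σ * π) ^ (n + 1 - k)) i : ℕ)) +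
        ((((σ * π) ^ (n + 1 - k)) i : ℕ) - (j : ℕ)))) = 0) ↔
        s.reg 13 = 0 ∧ ((σ * π) ^ (n + 1 - k)) i ≠ j := by
      rw [ne_eq, Fin.ext_iff]
      omega
    refine ⟨by simp [orbitBody, block, eval, r6], ?_⟩
    have e' : (orbitBody.eval s).reg 13 = s.reg 13 + (1 - (((j : ℕ) -
        (((σ * π) ^ (n + 1 - k)) i : ℕ)) + ((((σ * π) ^ (n + 1 - k)) i : ℕ) - (j : ℕ)))) := by
      simp [orbitBody, block, eval, r6, r5, hh.reg1]
    rw [e', hz, hi.2]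
    constructor
    · rintro ⟨h₁, h₂⟩ t ht ht'
      rcases Nat.lt_or_ge t (n + 1 - k) with hlt | hge
      · exact h₁ t ht (by omega)
      · rwa [le_antisymm ht' hge]
    · exact fun h₁ => ⟨fun t ht ht' => h₁ t ht (by omega), h₁ _ (by omega) le_rfl⟩
  · rintro s - ⟨-, hs⟩
    rw [hs]
    constructor
    · intro h₁ h₂
      obtain ⟨t, ht, ht', e⟩ := h₂.exists_pow_le_card hij
      rw [Fintype.card_fin] at ht'
      exact h₁ t ht (by omega) e
    · rintro h₁ t - - e
      exact h₁ ⟨t, by simpa using e⟩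

/-- Registers `10`, `11` and `12` describe the best open edge from `k` on. -/
def BestEdge (x y : Fin (n + 1) → ℕ) (σ π : Perm (Fin (n + 1))) (k : ℕ) (s : RamState) : Prop :=
  (s.reg 10 = 0 ∧ ∀ j ∈ openEdges σ π, (j : ℕ) < k) ∨
    (s.reg 10 ≠ 0 ∧ ∃ i ∈ openEdges σ π, s.reg 11 = i ∧ s.reg 12 = gap x y i ∧
      ∀ j ∈ openEdges σ π, k ≤ (j : ℕ) → gap x y i ≤ gap x y j)

/-- A bound for the number of steps of `testEdge`. -/
def testSteps (N : ℕ) : ℕ :=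
  initOrbit.steps + (N * (orbitBody.steps + 2) + 1 + (compareEdge.steps + 1))

theorem steps_pos_of_loopFree {p : RamProgram} (h : p.loopFree = true) : 1 ≤ p.steps := by
  induction p with
  | seq p q ihp ihq =>
    simp only [loopFree, Bool.and_eq_true] at h
    have := ihp h.1
    rw [steps]
    omega
  | loop => simp [loopFree] at h
  | _ => simp [steps]

theorem wp_testEdge {s₀ : RamState} (h : Holds x y σ π s₀) (i : Fin n) (h4 : s₀.reg 4 = i)
    (hb : BestEdge x y σ π (i + 1) s₀) :
    testEdge.Wp (testSteps (n + 1)) (BestEdge x y σ π i) s₀ := by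
  refine Wp.seq (wp_eval (by decide) (Wp.seq ?_))
  generalize hs₁ : initOrbit.eval s₀ = s₁
  have hf₁ : initOrbit.Frame s₀ s₁ := hs₁ ▸ frame_eval (by decide) s₀
  have h₁ := h.of_frame hf₁ (by decide) (by decide)
  refine (wp_orbitLoop h₁ (i := i.castSucc) (j := i.succ) Fin.castSucc_lt_succ.ne ?_ ?_ ?_ ?_).mono
    le_rfl fun s hf hs => ?_
  · simp [← hs₁, initOrbit, block, eval, h4, h.reg1]
  · simp [← hs₁, initOrbit, block, eval, h4, h.reg9]
  · simp [← hs₁, initOrbit, block, eval, h.reg2, h.reg9]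
  · simp [← hs₁, initOrbit, block, eval]
  have hh := h₁.of_frame hf (by decide) (by decide)
  have r4 : s.reg 4 = i := by rw [hf.1 4 (by decide), hf₁.1 4 (by decide), h4]
  have r5 : s.reg 5 = i + 1 := by
    rw [hf.1 5 (by decide)]
    simp [← hs₁, initOrbit, block, eval, h4, h.reg1]
  have r10 : s.reg 10 = s₀.reg 10 := by rw [hf.1 10 (by decide), hf₁.1 10 (by decide)]
  have r11 : s.reg 11 = s₀.reg 11 := by rw [hf.1 11 (by decide), hf₁.1 11 (by decide)]
  have r12 : s.reg 12 = s₀.reg 12 := by rw [hf.1 12 (by decide), hf₁.1 12 (by decide)]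
  have hb' : BestEdge x y σ π (i + 1) s := by
    rw [BestEdge, r10, r11, r12]
    exact hb
  refine wp_cond (fun h13 => ?_) fun h13 => wp_eval (by decide) ?_
  · refine (wp_eval (p := skip) rfl (Q := BestEdge x y σ π i) ?_).mono
      (steps_pos_of_loopFree (by decide)) fun _ _ h => h
    have hi : i ∉ openEdges σ π := fun hi => h13 (hs.2 (Finset.mem_filter.1 hi).2)
    have hne : ∀ j ∈ openEdges σ π, (j : ℕ) ≠ i := fun j hj e => hi (Fin.ext e ▸ hj)
    rcases hb' with ⟨a, b⟩ | ⟨a, k, hk, e₁, e₂, b⟩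
    · refine .inl ⟨a, fun j hj => ?_⟩
      have := b j hj
      have := hne j hj
      omega
    · refine .inr ⟨a, k, hk, e₁, e₂, fun j hj hij => b j hj ?_⟩
      have := hne j hj
      omega
  · have hi : i ∈ openEdges σ π := Finset.mem_filter.2 ⟨Finset.mem_univ _, hs.1 h13⟩
    have x₁ : s.arr 3 i = x i.castSucc := hh.ac i.castSucc
    have y₁ : s.arr 4 i = y i.castSucc := hh.br i.castSucc
    have x₂ : s.arr 3 (i + 1) = x i.succ := hh.ac i.succ
    have y₂ : s.arr 4 (i + 1) = y i.succ := hh.br i.succ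
    -- `a - (a - b)` is the minimum and `a + (b - a)` the maximum.
    have hg : x i.succ - (x i.succ - y i.succ) -
        (x i.castSucc + (y i.castSucc - x i.castSucc)) = gap x y i := by
      rw [gap]
      omega
    have hlast : ∀ j : Fin n, (i : ℕ) ≤ j → j ≠ i → (i : ℕ) + 1 ≤ j := fun j hj hne => by
      have : (j : ℕ) ≠ i := fun e => hne (Fin.ext e)
      omega
    rcases hb' with ⟨a, b⟩ | ⟨a, k, hk, e₁, e₂, b⟩
    · refine .inr ?_
      simp [compareEdge, recordEdge, block, eval, r4, r5, x₁, x₂, y₁, y₂, hg, a, hh.reg9]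
      refine ⟨i, hi, rfl, rfl, fun j hj hij => ?_⟩
      rcases eq_or_ne j i with rfl | hne
      · exact le_rfl
      · have := b j hj
        have := hlast j hij hne
        omega
    · refine .inr ?_
      by_cases hlt : gap x y k - gap x y i = 0
      · simp [compareEdge, recordEdge, block, eval, r4, r5, x₁, x₂, y₁, y₂, hg, a, e₂, hlt]
        refine ⟨k, hk, e₁, rfl, fun j hj hij => ?_⟩
        rcases eq_or_ne j i with rfl | hne
        · omega
        · exact b j hj (hlast j hij hne)
      · simp [compareEdge, recordEdge, block, eval, r4, r5, x₁, x₂, y₁, y₂, hg, a, hh.reg9, e₂,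
          hlt]
        refine ⟨i, hi, rfl, rfl, fun j hj hij => ?_⟩
        rcases eq_or_ne j i with rfl | hne
        · exact le_rfl
        · have := b j hj (hlast j hij hne)
          omega

/-- A bound for the number of steps of `searchEdge`. -/
def searchSteps (n : ℕ) : ℕ := initSearch.steps + (n * (testSteps (n + 1) + 2) + 1)

theorem wp_searchEdge {s₀ : RamState} (h : Holds x y σ π s₀) :
    searchEdge.Wp (searchSteps n) (BestEdge x y σ π 0) s₀ := by
  refine Wp.seq (wp_eval (by decide) ?_)
  generalize hs₁ : initSearch.eval s₀ = s₁
  have hf₁ : initSearch.Frame s₀ s₁ := hs₁ ▸ frame_eval (by decide) s₀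
  have h₁ := h.of_frame hf₁ (by decide) (by decide)
  refine wp_forDown (m := n) (BestEdge x y σ π) (by decide) (by decide) ?_ h₁.reg1
    (fun _ _ h => h) (.inl ⟨?_, fun j _ => j.2⟩) fun k hk s hf hs hb => ?_
  · simp [← hs₁, initSearch, block, eval, h.reg0, h.reg9]
  · simp [← hs₁, initSearch, block, eval]
  · exact wp_testEdge (h₁.of_frame hf (by decide) (by decide)) ⟨k, hk⟩ hs hb

theorem holds_exchangeEdge {s : RamState} (h : Holds x y σ π s) {i : Fin n} (h11 : s.reg 11 = i)
    (hne : lowJump x y π i ≠ highJump x y π i) :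
    Holds x y σ (exchange x y π i) (exchangeEdge.eval s) := by
  have hf : exchangeEdge.Frame s (exchangeEdge.eval s) := frame_eval (by decide) s
  have x₁ : s.arr 3 i = x i.castSucc := h.ac i.castSucc
  have y₁ : s.arr 4 i = y i.castSucc := h.br i.castSucc
  have x₂ : s.arr 3 (i + 1) = x i.succ := h.ac i.succ
  have y₂ : s.arr 4 (i + 1) = y i.succ := h.br i.succ
  have v₁ : s.arr 8 i = (π⁻¹ i.castSucc : Fin (n + 1)) := h.inv i.castSucc
  have v₂ : s.arr 8 (i + 1) = (π⁻¹ i.succ : Fin (n + 1)) := h.inv i.succ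
  generalize hs₁ : selectJumps.eval s = s₁
  have hf₁ : selectJumps.Frame s s₁ := hs₁ ▸ frame_eval (by decide) s
  have h₁ := h.of_frame hf₁ (by decide) (by decide)
  have hr : s₁.reg 26 = lowJump x y π i ∧ s₁.reg 27 = highJump x y π i := by
    rw [← hs₁, lowJump, highJump]
    split_ifs with c₁ c₂ c₂ <;>
      simp [selectJumps, block, eval, h11, h.reg1, h.reg9, x₁, y₁, v₁, x₂, y₂, v₂,
        Nat.sub_eq_zero_iff_le, c₁, c₂]
  -- For each array the outer case belongs to the later of the two stores.
  have key : ∀ p : Fin (n + 1),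
      (exchangeEdge.eval s).arr 7 p = (if p = highJump x y π i then π (lowJump x y π i)
        else if p = lowJump x y π i then π (highJump x y π i) else π p : Fin (n + 1)) ∧
      (exchangeEdge.eval s).arr 8 p = (if p = π (lowJump x y π i) then highJump x y π i
        else if p = π (highJump x y π i) then lowJump x y π i else π⁻¹ p : Fin (n + 1)) := by
    intro p
    rw [exchangeEdge, eval, hs₁]
    simp only [swapJumps, block, eval, RamState.setArr_arr, RamState.setArr_reg,
      RamState.setReg_reg, RamState.setReg_arr, hr.1, hr.2, h₁.perm, h₁.inv]
    simp [apply_ite Fin.val, Fin.ext_iff, h₁.perm]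
  refine ⟨(hf.1 0 (by decide)).trans h.reg0, (hf.1 1 (by decide)).trans h.reg1,
    (hf.1 2 (by decide)).trans h.reg2, (hf.1 9 (by decide)).trans h.reg9,
    by rw [hf.2 3 (by decide)]; exact h.ac, by rw [hf.2 4 (by decide)]; exact h.br,
    by rw [hf.2 5 (by decide)]; exact h.pos, fun p => ?_, fun p => ?_⟩
  · rw [(key p).1, exchange, mul_apply]
    congr 1
    rw [swap_apply_def]
    split_ifs <;> simp_all
  · rw [(key p).2, exchange, mul_inv_rev, swap_inv, mul_apply, swap_apply_def]
    congr 1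
    have e : ∀ q, π⁻¹ p = q ↔ p = π q := fun q => by rw [inv_eq_iff_eq, eq_comm]
    simp only [e]

/-- A bound for the number of steps of `mergePhase`. -/
def mergeSteps (n : ℕ) : ℕ :=
  1 + ((n + 1) * (searchSteps n + (exchangeEdge.steps + 1) + 2) + 1)

/-- There are at most `n` open edges, and every round that finds one lowers their number; so `n + 1`
rounds suffice. -/
theorem wp_mergePhase {s₀ : RamState} (hx : Monotone x) (hy : Monotone y)
    (h : Holds x y σ 1 s₀) :
    mergePhase.Wp (mergeSteps n) (fun s => ∃ π, Holds x y σ π s ∧ MergeInv x y σ π ∧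
      ∀ p q, (σ * π).SameCycle p q) s₀ := by
  refine Wp.seq (wp_eval (p := add 3 2 9) rfl ?_)
  generalize hs₁ : (add 3 2 9).eval s₀ = s₁
  have hf₁ : (add 3 2 9).Frame s₀ s₁ := hs₁ ▸ frame_eval (by decide) s₀
  have h₁ := h.of_frame hf₁ (by decide) (by decide)
  refine (wp_forDown (m := n + 1) (fun k s => ∃ π, Holds x y σ π s ∧ MergeInv x y σ π ∧
    (openEdges σ π).card ≤ k) (by decide) (by decide) ?_ h₁.reg1 ?_
    ⟨1, h₁, mergeInv_one hx hy σ, ?_⟩ ?_).mono le_rfl ?_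
  · simp [← hs₁, eval, h.reg2, h.reg9]
  · rintro k s ⟨π, hh, hm, hc⟩
    exact ⟨π, ⟨hh.reg0, hh.reg1, hh.reg2, hh.reg9, hh.ac, hh.br, hh.pos, hh.perm, hh.inv⟩, hm, hc⟩
  · exact (Finset.card_le_univ _).trans (by simp)
  · rintro k hk s hf hs ⟨π, hh, hm, hc⟩
    refine Wp.seq ((wp_searchEdge hh).mono le_rfl fun s' hf' hb => ?_)
    have hh' := hh.of_frame hf' (by decide) (by decide)
    refine wp_cond (fun h10 => wp_eval (by decide) ?_) fun h10 => ?_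
    · rcases hb with ⟨a, -⟩ | ⟨-, i, hi, e, -, hmin⟩
      · exact absurd a h10
      · refine ⟨exchange x y π i, holds_exchangeEdge hh' e ?_,
          hm.exchange hx hy hi fun j hj => hmin j hj (Nat.zero_le _), ?_⟩
        · intro e
          have := hm.not_sameCycle_jump hi
          rw [e] at this
          exact this (SameCycle.refl _ _)
        · have := hm.card_openEdges_exchange hi
          omega
    · refine (wp_eval (p := skip) rfl ?_).mono (steps_pos_of_loopFree (by decide)) fun _ _ h => h
      rcases hb with ⟨-, b⟩ | ⟨a, -⟩
      · refine ⟨π, hh', hm, ?_⟩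
        rw [Finset.card_eq_zero.2 (Finset.eq_empty_of_forall_notMem fun j hj =>
          absurd (b j hj) (Nat.not_lt_zero _))]
        exact Nat.zero_le _
      · exact absurd h10 a
  · rintro s - ⟨π, hh, hm, hc⟩
    exact ⟨π, hh, hm, sameCycle_of_openEdges_eq_empty (Finset.card_eq_zero.1 (Nat.le_zero.1 hc))⟩

/-- A bound for the number of steps of `outputPhase`. -/
def outputSteps (n : ℕ) : ℕ := initOutput.steps + (n * (outputBody.steps + 2) + 1)

/-- The walk starts at position `0` and moves before it writes, hence the exponent `i + 1`. -/
theorem wp_outputPhase {s₀ : RamState} (h : Holds x y σ π s₀) (f : Fin (n + 1) → ℕ)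
    (hline : ∀ p : Fin (n + 1), s₀.arr 6 p = f p) :
    outputPhase.Wp (outputSteps n) (fun s => ∀ i < n,
      s.arr 2 (2 * i) = 2 * f (((σ * π) ^ (i + 1)) 0) ∧
      s.arr 2 (2 * i + 1) = 2 * f (((σ * π) ^ (i + 1)) 0) + 1) s₀ := by
  refine Wp.seq (wp_eval (by decide) ?_)
  generalize hs₁ : initOutput.eval s₀ = s₁
  have hf₁ : initOutput.Frame s₀ s₁ := hs₁ ▸ frame_eval (by decide) s₀
  have h₁ := h.of_frame hf₁ (by decide) (by decide)
  refine (wp_forDown (c := 3) (m := n) (fun k s => s.reg 6 = ((σ * π) ^ (n - k)) 0 ∧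
    s.reg 4 = 2 * (n - k) ∧ ∀ i < n - k,
      s.arr 2 (2 * i) = 2 * f (((σ * π) ^ (i + 1)) 0) ∧
      s.arr 2 (2 * i + 1) = 2 * f (((σ * π) ^ (i + 1)) 0) + 1) (by decide) (by decide) ?_ h₁.reg1
    (fun _ _ h => h) ⟨?_, ?_, by omega⟩ ?_).mono le_rfl fun s _ h => h.2.2
  · simp [← hs₁, initOutput, block, eval, h.reg0, h.reg9]
  · simp [← hs₁, initOutput, block, eval]
  · simp [← hs₁, initOutput, block, eval]
  · rintro k hk s hf hs ⟨r6, r4, ho⟩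
    refine wp_eval (by decide) ?_
    have hh := h₁.of_frame hf (by decide) (by decide)
    have hl : s.arr 6 = s₀.arr 6 := (hf.2 6 (by decide)).trans (hf₁.2 6 (by decide))
    obtain ⟨m, hm⟩ : ∃ m, m = n - (k + 1) := ⟨_, rfl⟩
    have e : n - k = m + 1 := by omega
    rw [← hm] at r6 r4 ho
    have r6' : s.arr 5 (s.arr 7 (s.reg 6)) = ((σ * π) ^ (m + 1)) 0 := by
      rw [r6, hh.perm, hh.pos, pow_succ', mul_apply, mul_apply]
    have r10 : s.arr 6 (((σ * π) ^ (m + 1)) 0 : Fin (n + 1)) = f (((σ * π) ^ (m + 1)) 0) := by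
      rw [hl, hline]
    rw [e]
    refine ⟨by simp [outputBody, block, eval, r6'],
      by simp [outputBody, block, eval, r4, hh.reg1]; ring, fun i hi => ?_⟩
    rcases Nat.lt_succ_iff_lt_or_eq.1 hi with hlt | rfl
    · rw [← (ho i hlt).2, ← (ho i hlt).1]
      constructor
      · simp [outputBody, block, eval, r4, hh.reg1]
        split_ifs <;> omega
      · simp [outputBody, block, eval, r4, hh.reg1]
        split_ifs <;> omega
    · constructor
      · simp [outputBody, block, eval, r4, hh.reg1, r6', r10]
        omega
      · simp [outputBody, block, eval, r4, hh.reg1, r6', r10]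
        omega

end RamProgram

/-! ### The main theorem -/

namespace EnergyInstance

open RamProgram

variable (I : EnergyInstance)

/-- Every line adds at least `1` to the encoding length, so a polynomial in `n` is harmless. -/
theorem n_le_inputSize : I.n ≤ I.inputSize := by
  have h : ∑ _ℓ : Fin I.n, 1 ≤ ∑ ℓ, (bitCost (I.tAc ℓ) + bitCost (I.tBr ℓ)) :=
    Finset.sum_le_sum fun ℓ _ => by
      rw [bitCost]
      omega
  simp only [Finset.sum_const, Finset.card_univ, Fintype.card_fin, smul_eq_mul, mul_one] at h
  rw [inputSize]
  omega

theorem bounded_inputState : I.inputState.Bounded I.inputSize := by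
  have h : ∀ ℓ, bitCost (I.tAc ℓ) + bitCost (I.tBr ℓ) ≤
      ∑ ℓ, (bitCost (I.tAc ℓ) + bitCost (I.tBr ℓ)) := fun ℓ =>
    Finset.single_le_sum (f := fun ℓ => bitCost (I.tAc ℓ) + bitCost (I.tBr ℓ))
      (fun _ _ => Nat.zero_le _) (Finset.mem_univ ℓ)
  constructor
  · intro x
    rw [inputState, inputSize, bitCost]
    dsimp only
    split_ifs
    · omega
    · simp
  · intro a i
    rw [inputState, inputSize]
    dsimp only
    split_ifs with hi
    · have := h ⟨i, hi⟩
      rw [bitCost] at this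
      omega
    · have := h ⟨i, hi⟩
      simp only [bitCost] at this ⊢
      omega
    all_goals simp

theorem inputState_arr_zero : I.inputState.arr 0 = I.extAc := by
  funext i
  simp [inputState, extAc]

theorem inputState_arr_one : I.inputState.arr 1 = I.extBr := by
  funext i
  simp [inputState, extBr]

theorem holds_of_sorted {s : RamState} (h0 : s.reg 0 = I.n) (h1 : s.reg 1 = 1)
    (h2 : s.reg 2 = I.n + 1) (h9 : s.reg 9 = 0) (h : Sorted I.extAc I.extBr (I.n + 1) 0 s) :
    Holds I.sortedAc I.sortedBr I.posPerm 1 s := by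
  have hA : ∀ p, keyRank I.extAc (I.n + 1) ((keyRank.perm I.extAc I.n).symm p) = (p : ℕ) :=
    fun p => by rw [← keyRank.perm_val, Equiv.apply_symm_apply]
  have hB : ∀ p, keyRank I.extBr (I.n + 1) ((keyRank.perm I.extBr I.n).symm p) = (p : ℕ) :=
    fun p => by rw [← keyRank.perm_val, Equiv.apply_symm_apply]
  refine ⟨h0, h1, h2, h9, fun p => ?_, fun p => ?_, fun p => ?_, fun p => ?_, fun p => ?_⟩
  · rw [← hA p, h.ac _ (Nat.zero_le _) (Fin.is_lt _), sortedAc]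
  · rw [← hB p, h.br _ (Nat.zero_le _) (Fin.is_lt _), sortedBr]
  · rw [← hB p, h.pos _ (Nat.zero_le _) (Fin.is_lt _)]
    rfl
  · exact h.perm p (Nat.zero_le _) p.2
  · exact h.inv p (Nat.zero_le _) p.2

theorem wp_pathProgram :
    pathProgram.Wp (sortSteps (I.n + 1) + (mergeSteps I.n + outputSteps I.n)) (fun s =>
      ∃ P : List (StationEvent I.n), s.HoldsPath P ∧ I.IsMaxWeightPath P) I.inputState := by
  have i0 : I.inputState.reg 0 = I.n := rfl
  have i9 : I.inputState.reg 9 = 0 := rfl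
  refine Wp.seq ((wp_sortPhase i0 i9).mono le_rfl fun s hf ⟨h1, h2, hs⟩ => ?_)
  rw [inputState_arr_zero, inputState_arr_one] at hs
  have h := I.holds_of_sorted ((hf.1 0 (by decide)).trans i0) h1 h2
    ((hf.1 9 (by decide)).trans i9) hs
  refine Wp.seq ((wp_mergePhase I.monotone_sortedAc I.monotone_sortedBr h).mono le_rfl
    fun s' hf' ⟨π, h', hm, hc⟩ => ?_)
  refine (wp_outputPhase h' (fun p => (keyRank.perm I.extAc I.n).symm p) fun p => ?_).mono le_rfl
    fun t _ ht => ?_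
  · rw [hf'.2 6 (by decide)]
    have := hs.line _ (Nat.zero_le _) ((keyRank.perm I.extAc I.n).symm p).2
    rwa [← keyRank.perm_val, Equiv.apply_symm_apply] at this
  · obtain ⟨L, hL, hlen, hget⟩ := I.exists_isMaxWeightPath hm hc
    refine ⟨linePath L, fun i hi => ?_, hL⟩
    have hlen' := length_linePath L
    have hi' : i / 2 < L.length := by omega
    have hg := getElem_linePath hi' (by omega) (by omega)
    have hv : (L[i / 2] : ℕ) =
        (keyRank.perm I.extAc I.n).symm (((I.posPerm * π) ^ (i / 2 + 1)) 0) := by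
      rw [← hget (i / 2) hi', Fin.val_castSucc]
    have ho := ht (i / 2) (by omega)
    rw [← hv] at ho
    rcases Nat.mod_two_eq_zero_or_one i with h₀ | h₀
    · have e : i = 2 * (i / 2) := by omega
      have e' : (linePath L)[i] = StationEvent.arr L[i / 2] := by
        rw [← hg.1]
        congr 1
      rw [e', StationEvent.code, ← ho.1, ← e]
    · have e : i = 2 * (i / 2) + 1 := by omega
      have e' : (linePath L)[i] = StationEvent.dep L[i / 2] := by
        rw [← hg.2]
        congr 1
      rw [e', StationEvent.code, ← ho.2, ← e]

/-- The number of steps of the program is bounded by a polynomial. -/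
theorem exists_polynomial_steps : ∃ p : Polynomial ℕ, ∀ n,
    p.eval n = sortSteps (n + 1) + (mergeSteps n + outputSteps n) := by
  open Polynomial in
  refine ⟨(C initRegs.steps + ((X + 1) * (C loadLine.steps + ((X + 1) * (C rankBody.steps + 2) + 1 +
    C placeLine.steps) + 2) + 1)) + ((1 + ((X + 1) * ((C initSearch.steps + (X * ((C initOrbit.steps +
    ((X + 1) * (C orbitBody.steps + 2) + 1 + (C compareEdge.steps + 1))) + 2) + 1)) +
    (C exchangeEdge.steps + 1) + 2) + 1)) + (C initOutput.steps + (X * (C outputBody.steps + 2) +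
    1))), fun n => ?_⟩
  simp only [eval_add, eval_mul, eval_C, eval_X, eval_one, eval_ofNat, sortSteps, mergeSteps,
    outputSteps, searchSteps, testSteps]

end EnergyInstance

theorem monotone_polynomial_eval (p : Polynomial ℕ) : Monotone fun n => p.eval n := by
  intro m n h
  simp only [Polynomial.eval_eq_sum_range]
  gcongr

theorem mainTheorem7 :
    ∃ (prog : RamProgram) (p : Polynomial ℕ), ∀ I : EnergyInstance,
      ∃ (s : RamState) (t : ℕ) (P : List (StationEvent I.n)),
        RamRuns prog I.inputState s t ∧ t ≤ p.eval I.inputSize ∧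
          s.HoldsPath P ∧ I.IsMaxWeightPath P := by
  obtain ⟨q, hq⟩ := EnergyInstance.exists_polynomial_steps
  -- This is the cost bound of `Exec` with `q` in place of the number of steps and the input size in
  -- place of the initial bit length.
  refine ⟨RamProgram.pathProgram, q * (2 * (Polynomial.X + q) + 2), fun I => ?_⟩
  obtain ⟨s, m, hm, he, -, P, hP, hmax⟩ := I.wp_pathProgram
  obtain ⟨-, t, ht, hle⟩ := he _ I.bounded_inputState
  refine ⟨s, t, P, ht, hle.trans ?_, hP, hmax⟩
  have hmq : m ≤ q.eval I.inputSize := by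
    rw [← hq] at hm
    exact hm.trans (monotone_polynomial_eval q I.n_le_inputSize)
  simp only [Polynomial.eval_add, Polynomial.eval_mul, Polynomial.eval_X, Polynomial.eval_ofNat]
  gcongr
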